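/- Let $n,\tau,d$ be natural numbers with $n,\tau\ge 1$, let $\varepsilon\in\mathbb R$, and let $\mathcal X$ be a set of $n$ entities moving in $\mathbb{R}^d$ along piecewise linear trajectories, each with $\tau$ edges and with its vertices at the common times $t_0<t_1<\dots<t_\tau$; write $\sigma(t)$ for the position of $\sigma\in\mathcal X$ at time $t\in[t_0,t_\tau]$. Put $D(\sigma,t)=\max_{\psi\in\mathcal X}\|\sigma(t)-\psi(t)\|$. Two entities $\sigma,\psi$ are $\varepsilon$-connected at time $t$ if there is a sequence $\sigma=\sigma_0,\dots,\sigma_k=\psi$ ($k\ge 0$) of entities with $\|\sigma_i(t)-\sigma_{i+1}(t)\|\le\varepsilon$ for all $i<k$. A trajectoid is a measurable map $T:[t_0,t_\tau]\to\mathcal X$ that at every time $t$ jumps only between entities that are $\varepsilon$-connected at time $t$: every entity that is a value of $T$ at times arbitrarily close to $t$ is $\varepsilon$-connected to $T(t)$ at time $t$. A central trajectory is a trajectoid $\mathcal C$ that minimises $$\mathcal D(T)=\int_{t_0}^{t_\tau} D(T(t),t)\,dt$$ among all trajectoids $T$. The complexity of $\mathcal C$ is the number of its vertices, that is, of times that are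 discontinuities of $\mathcal C$ or belong to $\{t_0,\dots,t_\tau\}$. When different entities have the same value of $D$ throughout a time interval, a central trajectory may switch among them arbitrarily often. Call a jump of a central trajectory $\mathcal C$ at a time $s\in(t_0,t_\tau)$ arbitrary if there are an entity $\sigma$ that $\mathcal C$ takes at times $u<s$ arbitrarily close to $s$ and an entity $\psi$ that it takes at times $u>s$ arbitrarily close to $s$ such that for all sufficiently small $\delta>0$ both of the following are again central trajectories: $\mathcal C$ changed to $\sigma$ on $[s,s+\delta)$, and $\mathcal C$ changed to $\psi$ on $(s-\delta,s]$. Theorem. There is a central trajectory without arbitrary jumps, and every central trajectory without arbitrary jumps has complexity $O(\tau n^{5/2})$. That is, there is an absolute constant $K$ such that for all $d$, all $n,\tau\ge1$, all $\varepsilon$ and all inputs as above, every central trajectory without arbitrary jumps has at most $K\,\tau\,n^{5/2}$ vertices. -/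

import Mathlib

open Set Filter Topology MeasureTheory

/-- `n` entities moving in `ℝ^d` along piecewise linear trajectories with `τ` edges each, all
trajectories having their vertices at the common times `time 0 < ⋯ < time τ`.  Only the values of
`pos σ` on `[time 0, time τ]` are meaningful. -/
structure MovingEntities (d n τ : ℕ) where
  time : Fin (τ + 1) → ℝ
  time_strictMono : StrictMono time
  pos : Fin n → ℝ → EuclideanSpace ℝ (Fin d)
  pos_linear : ∀ (σ : Fin n) (i : Fin τ), ∀ s ∈ Icc (time i.castSucc) (time i.succ),
    pos σ s = AffineMap.lineMap (pos σ (time i.castSucc)) (pos σ (time i.succ))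
      ((s - time i.castSucc) / (time i.succ - time i.castSucc))

namespace MovingEntities

variable {d n τ : ℕ}

/-- The whole time interval `[t_0, t_τ]`. -/
def span (X : MovingEntities d n τ) : Set ℝ :=
  Icc (X.time 0) (X.time (Fin.last τ))

/-- `D(σ, s)`: the distance at time `s` from `σ` to the entity farthest from it
(a maximum over a finite nonempty family). -/
noncomputable def farDist (X : MovingEntities d n τ) (σ : Fin n) (s : ℝ) : ℝ :=
  ⨆ ψ : Fin n, dist (X.pos σ s) (X.pos ψ s)

/-- `σ` and `ψ` are `ε`-connected at time `s`: they are joined by a (possibly trivial) sequence of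
entities in which consecutive entities are within distance `ε` of each other at time `s`. -/
def EpsConnected (X : MovingEntities d n τ) (ε : ℝ) (s : ℝ) (σ ψ : Fin n) : Prop :=
  Relation.ReflTransGen (fun a b => dist (X.pos a s) (X.pos b s) ≤ ε) σ ψ

/-- A trajectoid: a (measurable) map from time to entities that at every time `s` jumps only
between entities that are `ε`-connected at time `s`, that is, every entity that it takes at times
arbitrarily close to `s` (on either side) is `ε`-connected at time `s` to the one taken at `s`. -/
def IsTrajectoid (X : MovingEntities d n τ) (ε : ℝ) (T : ℝ → Fin n) : Prop :=
  Measurable T ∧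
    ∀ s ∈ X.span, ∀ ψ : Fin n, (∃ᶠ u in 𝓝[X.span] s, T u = ψ) → X.EpsConnected ε s (T s) ψ

/-- `𝒟(T) = ∫_{t_0}^{t_τ} D(T(s), s) ds`. -/
noncomputable def cost (X : MovingEntities d n τ) (T : ℝ → Fin n) : ℝ :=
  ∫ s in (X.time 0)..(X.time (Fin.last τ)), X.farDist (T s) s

/-- A central trajectory: a trajectoid that minimises `𝒟` among all trajectoids. -/
def IsCentral (X : MovingEntities d n τ) (ε : ℝ) (C : ℝ → Fin n) : Prop :=
  X.IsTrajectoid ε C ∧ ∀ T : ℝ → Fin n, X.IsTrajectoid ε T → X.cost C ≤ X.cost T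

/-- The discontinuities (jump times) of `C` in `[t_0, t_τ]`. -/
def breakTimes (X : MovingEntities d n τ) (C : ℝ → Fin n) : Set ℝ :=
  {s | s ∈ X.span ∧ ¬ ∀ᶠ u in 𝓝[X.span] s, C u = C s}

/-- The vertices of `C`: its jump times together with the times `t_0, …, t_τ`.  Between two
consecutive vertices `C` follows one edge of one input trajectory.  The complexity of `C` is the
number of its vertices. -/
def vertices (X : MovingEntities d n τ) (C : ℝ → Fin n) : Set ℝ :=
  X.breakTimes C ∪ range X.time

open Classical in
/-- `C`, modified so as to follow `σ` during the set of times `I`. -/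
noncomputable def follow (C : ℝ → Fin n) (I : Set ℝ) (σ : Fin n) : ℝ → Fin n :=
  fun u => if u ∈ I then σ else C u

/-- The jump of `C` at time `s` is arbitrary: the trajectory stays central if the jump is slightly
postponed (`C` keeps following an entity `σ` that it follows just before `s`), and also if it is
made slightly earlier (`C` already follows an entity `ψ` that it follows just after `s`). -/
def IsArbitraryJump (X : MovingEntities d n τ) (ε : ℝ) (C : ℝ → Fin n) (s : ℝ) : Prop :=
  ∃ σ ψ : Fin n, (∃ᶠ u in 𝓝[<] s, C u = σ) ∧ (∃ᶠ u in 𝓝[>] s, C u = ψ) ∧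
    ∀ᶠ δ in 𝓝[>] (0 : ℝ),
      X.IsCentral ε (follow C (Ico s (s + δ)) σ) ∧ X.IsCentral ε (follow C (Ioc (s - δ) s) ψ)

/-- `C` makes no arbitrary jumps. -/
def NoArbitraryJumps (X : MovingEntities d n τ) (ε : ℝ) (C : ℝ → Fin n) : Prop :=
  ∀ s ∈ X.breakTimes C, s ∈ Ioo (X.time 0) (X.time (Fin.last τ)) → ¬ X.IsArbitraryJump ε C s

end MovingEntities

/-!
Along one edge the squared distances between entities are quadratic in time, so each `D(σ, ·)²` is
an upper envelope of `n` quadratics. Such an envelope has at most `2 n` breakpoints, because a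
breakpoint is the last time on the envelope for the quadratic leaving it or the first time for the
one entering it (`encard_envelopeBreaks_le`; otherwise the two would cross three times). Together
with the times at which a pair of entities comes within distance `ε` or ceases to be so, this gives
a set of `O(τ n²)` *cuts* (`encard_cuts_le`), between which all `D(σ, ·)²` are quadratic and the
components of `ε`-connectedness are fixed.

In a gap between consecutive cuts, a central trajectory stays in one component and almost always
follows a most central entity of it (`IsGap.ae_farDist_le`). At a time around which the lower
envelope of the component is a single quadratic, every jump is arbitrary, so the jumps of a
trajectory without arbitrary jumps are among the breakpoints of this envelope. There are at
most `2 r` of these if `r` different quadratics appear on it, and any two of the `r` meet during the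
gap. Two entities meet in this way `O(τ n)` times altogether (`encard_crossings_le`), so the sum of
`r² - r` over the gaps is `O(τ n³)`. As there are `O(τ n²)` gaps, the inequality
`r ≤ 1 + √n + (r² - r) / √n` shows that the sum of `r` is `O(τ n^{5/2})`.

For existence, cut the time interval at all cuts and crossings. In each part the components and the
order of the values of `D` are fixed, so every trajectoid is dominated by one that is constant on
each part (`IsFine.exists_isFeasible_cost_le`), and of these there are essentially finitely many.
Among the optimal ones, one whose jumps come as late as possible in the lexicographic sense has no
arbitrary jumps, since an arbitrary jump can be postponed to the end of the part that follows it.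
-/

/-! ### Quadratics -/

/-- `f` is a real polynomial function of degree at most two. -/
def IsQuad (f : ℝ → ℝ) : Prop :=
  ∃ a b c : ℝ, ∀ u, f u = a * u ^ 2 + b * u + c

namespace IsQuad

theorem sub {f g : ℝ → ℝ} (hf : IsQuad f) (hg : IsQuad g) : IsQuad (f - g) := by
  obtain ⟨a, b, c, h⟩ := hf
  obtain ⟨a', b', c', h'⟩ := hg
  exact ⟨a - a', b - b', c - c', fun u => by simp only [Pi.sub_apply, h, h']; ring⟩

theorem neg {f : ℝ → ℝ} (hf : IsQuad f) : IsQuad (-f) := by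
  obtain ⟨a, b, c, h⟩ := hf
  exact ⟨-a, -b, -c, fun u => by simp only [Pi.neg_apply, h]; ring⟩

theorem sub_const {f : ℝ → ℝ} (hf : IsQuad f) (k : ℝ) : IsQuad (fun u => f u - k) := by
  obtain ⟨a, b, c, h⟩ := hf
  exact ⟨a, b, c - k, fun u => by simp only [h]; ring⟩

theorem analyticAt {f : ℝ → ℝ} (hf : IsQuad f) (s : ℝ) : AnalyticAt ℝ f s := by
  obtain ⟨a, b, c, h⟩ := hf
  obtain rfl : f = fun u => a * u ^ 2 + b * u + c := funext h
  fun_prop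

theorem continuous {f : ℝ → ℝ} (hf : IsQuad f) : Continuous f :=
  continuous_iff_continuousAt.2 fun s => (hf.analyticAt s).continuousAt

theorem eq_zero_of_three_zeros {f : ℝ → ℝ} (hf : IsQuad f) {x y z : ℝ} (hxy : x ≠ y) (hyz : y ≠ z)
    (hxz : x ≠ z) (hx : f x = 0) (hy : f y = 0) (hz : f z = 0) : f = 0 := by
  obtain ⟨a, b, c, h⟩ := hf
  rw [h] at hx hy hz
  have h1 : a * (x + y) + b = 0 :=
    mul_left_cancel₀ (sub_ne_zero.2 hxy) (by linear_combination hx - hy)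
  have h2 : a * (y + z) + b = 0 :=
    mul_left_cancel₀ (sub_ne_zero.2 hyz) (by linear_combination hy - hz)
  obtain rfl : a = 0 := mul_left_cancel₀ (sub_ne_zero.2 hxz) (by linear_combination h1 - h2)
  obtain rfl : b = 0 := by linarith
  obtain rfl : c = 0 := by linarith
  funext u
  simp [h]

theorem eq_of_three_eq {f g : ℝ → ℝ} (hf : IsQuad f) (hg : IsQuad g) {x y z : ℝ} (hxy : x < y)
    (hyz : y < z) (hx : f x = g x) (hy : f y = g y) (hz : f z = g z) : f = g :=
  sub_eq_zero.1 <| (hf.sub hg).eq_zero_of_three_zeros hxy.ne hyz.ne (hxy.trans hyz).ne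
    (sub_eq_zero.2 hx) (sub_eq_zero.2 hy) (sub_eq_zero.2 hz)

theorem encard_zeros_le {f : ℝ → ℝ} (hf : IsQuad f) (h0 : f ≠ 0) : {s | f s = 0}.encard ≤ 2 := by
  by_contra! h
  obtain ⟨t, ht, ht3⟩ := Set.exists_subset_encard_eq (s := {s | f s = 0}) (k := 3)
    (by
      have := Order.add_one_le_of_lt h
      rwa [show (2 : ℕ∞) + 1 = 3 by norm_num] at this)
  obtain ⟨x, y, z, hxy, hxz, hyz, rfl⟩ := Set.encard_eq_three.1 ht3
  exact h0 (hf.eq_zero_of_three_zeros hxy hyz hxz (ht (by simp)) (ht (by simp)) (ht (by simp)))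

theorem eventually_ne {f g : ℝ → ℝ} (hf : IsQuad f) (hg : IsQuad g) (hfg : f ≠ g) (s : ℝ) :
    ∀ᶠ u in 𝓝[≠] s, f u ≠ g u := by
  have hfin : {u | (f - g) u = 0}.Finite :=
    Set.finite_of_encard_le_coe ((hf.sub hg).encard_zeros_le (sub_ne_zero.2 hfg))
  rw [eventually_nhdsWithin_iff]
  have hfin' := hfin.subset (sdiff_subset (t := {s}))
  filter_upwards [hfin'.isClosed.isOpen_compl.mem_nhds (by simp : s ∈ _)] with u hu hus heq
  exact hu ⟨by simp [heq], hus⟩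

theorem eq_of_frequently_eq {f g : ℝ → ℝ} (hf : IsQuad f) (hg : IsQuad g) {s : ℝ}
    (h : ∃ᶠ u in 𝓝[≠] s, f u = g u) : f = g := by
  by_contra hfg
  exact h (hf.eventually_ne hg hfg s)

/-- On either side of a point, a quadratic eventually has constant sign. -/
theorem eventually_le_or {f g : ℝ → ℝ} (hf : IsQuad f) (hg : IsQuad g) (s : ℝ) {l : Filter ℝ}
    (hl : l = 𝓝[<] s ∨ l = 𝓝[>] s) : (∀ᶠ u in l, f u ≤ g u) ∨ ∀ᶠ u in l, g u ≤ f u := by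
  have hls : l ≤ 𝓝 s := by rcases hl with rfl | rfl <;> exact nhdsWithin_le_nhds
  obtain ⟨a, b, c, h⟩ := hg.sub hf
  -- Expand the difference around `s`; the lowest nonvanishing coefficient decides the sign.
  have hexp : ∀ u, g u - f u = (g s - f s) + (u - s) * ((2 * a * s + b) + a * (u - s)) := by
    intro u
    have h1 := h u
    have h2 := h s
    simp only [Pi.sub_apply] at h1 h2
    rw [h1, h2]; ring
  have hc : Continuous fun u => g u - f u := hg.continuous.sub hf.continuous
  rcases lt_trichotomy (g s - f s) 0 with h0 | h0 | h0
  · right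
    filter_upwards [hls (hc.continuousAt.eventually_lt continuousAt_const h0)] with u hu
    linarith
  · have hc' : Continuous fun u => (2 * a * s + b) + a * (u - s) := by fun_prop
    rcases lt_trichotomy (2 * a * s + b) 0 with h1 | h1 | h1
    · have := hls (hc'.continuousAt.eventually_lt (x₀ := s) continuousAt_const (by simpa using h1))
      rcases hl with rfl | rfl
      · left
        filter_upwards [this, self_mem_nhdsWithin] with u hu hus
        have := mul_pos_of_neg_of_neg (sub_neg.2 hus) hu
        linarith [hexp u]
      · right
        filter_upwards [this, self_mem_nhdsWithin] with u hu hus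
        have := mul_neg_of_pos_of_neg (sub_pos.2 hus) hu
        linarith [hexp u]
    · rcases le_total 0 a with ha | ha
      · left
        refine Eventually.of_forall fun u => ?_
        have := mul_nonneg ha (sq_nonneg (u - s))
        have e := hexp u
        rw [h0, h1] at e
        linarith [show (u - s) * (0 + a * (u - s)) = a * (u - s) ^ 2 by ring]
      · right
        refine Eventually.of_forall fun u => ?_
        have := mul_nonneg (neg_nonneg.2 ha) (sq_nonneg (u - s))
        have e := hexp u
        rw [h0, h1] at e
        linarith [show (u - s) * (0 + a * (u - s)) = a * (u - s) ^ 2 by ring]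
    · have := hls (continuousAt_const.eventually_lt (x₀ := s) hc'.continuousAt (by simpa using h1))
      rcases hl with rfl | rfl
      · right
        filter_upwards [this, self_mem_nhdsWithin] with u hu hus
        have := mul_neg_of_neg_of_pos (sub_neg.2 hus) hu
        linarith [hexp u]
      · left
        filter_upwards [this, self_mem_nhdsWithin] with u hu hus
        have := mul_pos (sub_pos.2 hus) hu
        linarith [hexp u]
  · left
    filter_upwards [hls (continuousAt_const.eventually_lt hc.continuousAt h0)] with u hu
    linarith

theorem exists_eventually_min {F : Finset (ℝ → ℝ)} (hF : ∀ f ∈ F, IsQuad f) (hne : F.Nonempty)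
    (s : ℝ) {l : Filter ℝ} (hl : l = 𝓝[<] s ∨ l = 𝓝[>] s) :
    ∃ f ∈ F, ∀ᶠ u in l, ∀ g ∈ F, f u ≤ g u := by
  induction hne using Finset.Nonempty.cons_induction with
  | singleton f => exact ⟨f, by simp, by simp⟩
  | cons f F hf hne ih =>
    obtain ⟨g, hg, hgm⟩ := ih fun g hg => hF g (by simp [hg])
    rcases (hF f (by simp)).eventually_le_or (hF g (by simp [hg])) s hl with h | h
    · refine ⟨f, by simp, ?_⟩
      filter_upwards [h, hgm] with u hu hu'
      simp only [Finset.mem_cons, forall_eq_or_imp, le_refl, true_and]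
      exact fun k hk => hu.trans (hu' k hk)
    · refine ⟨g, by simp [hg], ?_⟩
      filter_upwards [h, hgm] with u hu hu'
      simp only [Finset.mem_cons, forall_eq_or_imp]
      exact ⟨hu, hu'⟩

end IsQuad

/-! ### Lower envelopes of quadratics -/

theorem exists_eq_of_le_of_ge {f g : ℝ → ℝ} (hf : Continuous f) (hg : Continuous g) {x y : ℝ}
    (hxy : x ≤ y) (hx : f x ≤ g x) (hy : g y ≤ f y) : ∃ z ∈ Icc x y, f z = g z := by
  obtain ⟨z, hz, h⟩ := intermediate_value_Icc hxy (hf.sub hg).continuousOn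
    (show (0 : ℝ) ∈ Icc ((f - g) x) ((f - g) y) from ⟨sub_nonpos.2 hx, sub_nonneg.2 hy⟩)
  exact ⟨z, hz, sub_eq_zero.1 h⟩

/-- At a breakpoint of a lower envelope of quadratics, the one leaving the envelope never appears
on it again, or the one entering it has not appeared before: otherwise the two would cross three
times. Here `f` leaves and `g` enters at `s`, while `g` is below `f` at an earlier time and `f`
below `g` at a later one. -/
theorem IsQuad.not_recross {f g : ℝ → ℝ} (hf : IsQuad f) (hg : IsQuad g) (hfg : f ≠ g) {s : ℝ}
    (hl : ∀ᶠ u in 𝓝[<] s, f u ≤ g u) (hr : ∀ᶠ u in 𝓝[>] s, g u ≤ f u) {x y : ℝ} (hx : x < s)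
    (hy : s < y) (hgx : g x ≤ f x) (hfy : f y ≤ g y) : False := by
  have hne := hf.eventually_ne hg hfg s
  obtain ⟨p, ⟨hp, hp'⟩, hpm⟩ := ((hl.and (hne.filter_mono (nhdsWithin_mono _ fun _ => ne_of_lt))).and
    (Ioo_mem_nhdsLT hx)).exists
  obtain ⟨q, ⟨hq, hq'⟩, hqm⟩ := ((hr.and (hne.filter_mono (nhdsWithin_mono _ fun _ => ne_of_gt))).and
    (Ioo_mem_nhdsGT hy)).exists
  obtain ⟨z₁, hz₁, h₁⟩ := exists_eq_of_le_of_ge hg.continuous hf.continuous hpm.1.le hgx hp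
  obtain ⟨z₂, hz₂, h₂⟩ := exists_eq_of_le_of_ge hf.continuous hg.continuous
    (hpm.2.trans hqm.1).le hp hq
  obtain ⟨z₃, hz₃, h₃⟩ := exists_eq_of_le_of_ge hg.continuous hf.continuous hqm.2.le hq hfy
  have e1 : z₁ ≠ p := fun h => hp' (by rw [← h, h₁])
  have e2 : z₂ ≠ p := fun h => hp' (by rw [← h, h₂])
  have e3 : z₂ ≠ q := fun h => hq' (by rw [← h, h₂])
  exact hfg (hf.eq_of_three_eq hg (hz₁.2.lt_of_ne e1 |>.trans (hz₂.1.lt_of_ne e2.symm))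
    ((hz₂.2.lt_of_ne e3).trans_le hz₃.1) h₁.symm h₂ h₃.symm)

open Classical in
/-- The members of `F` that appear on the lower envelope of `F` over the interval `(a, b)`. -/
noncomputable def envelopeMembers (F : Finset (ℝ → ℝ)) (a b : ℝ) : Finset (ℝ → ℝ) :=
  F.filter fun f => ∃ u ∈ Ioo a b, ∀ g ∈ F, f u ≤ g u

/-- The breakpoints in `(a, b)` of the lower envelope of `F`: around them no single member of `F`
realises the envelope. -/
def envelopeBreaks (F : Finset (ℝ → ℝ)) (a b : ℝ) : Set ℝ :=
  {s | s ∈ Ioo a b ∧ ¬ ∃ f ∈ F, ∀ᶠ u in 𝓝 s, ∀ g ∈ F, f u ≤ g u}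

/-- Each breakpoint is the last time on the envelope of the function leaving it or the first time
of the function entering it. -/
theorem encard_envelopeBreaks_le {F : Finset (ℝ → ℝ)} (hF : ∀ f ∈ F, IsQuad f) (hne : F.Nonempty)
    (a b : ℝ) : (envelopeBreaks F a b).encard ≤ (2 * (envelopeMembers F a b).card : ℕ) := by
  classical
  set R := envelopeMembers F a b with hR
  let A : (ℝ → ℝ) → Set ℝ := fun f => {u | u ∈ Ioo a b ∧ ∀ g ∈ F, f u ≤ g u}
  have key : envelopeBreaks F a b ⊆
      ((R.image fun f => sSup (A f)) ∪ (R.image fun f => sInf (A f)) : Finset ℝ) := by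
    rintro s ⟨hs, hbr⟩
    obtain ⟨f, hfF, hf⟩ := IsQuad.exists_eventually_min hF hne s (Or.inl rfl)
    obtain ⟨g, hgF, hg⟩ := IsQuad.exists_eventually_min hF hne s (Or.inr rfl)
    have hsf : ∀ k ∈ F, f s ≤ k s := fun k hk =>
      le_of_tendsto_of_tendsto ((hF f hfF).continuous.continuousWithinAt (s := Iio s))
        ((hF k hk).continuous.continuousWithinAt (s := Iio s)) (hf.mono fun u hu => hu k hk)
    have hsg : ∀ k ∈ F, g s ≤ k s := fun k hk =>
      le_of_tendsto_of_tendsto ((hF g hgF).continuous.continuousWithinAt (s := Ioi s))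
        ((hF k hk).continuous.continuousWithinAt (s := Ioi s)) (hg.mono fun u hu => hu k hk)
    have hfg : f ≠ g := by
      rintro rfl
      refine hbr ⟨f, hfF, ?_⟩
      rw [← nhdsNE_sup_pure, ← nhdsLT_sup_nhdsGT, eventually_sup, eventually_sup]
      exact ⟨⟨hf, hg⟩, hsf⟩
    have hfR : f ∈ R := by
      rw [hR]; exact Finset.mem_filter.2 ⟨hfF, s, hs, hsf⟩
    have hgR : g ∈ R := by
      rw [hR]; exact Finset.mem_filter.2 ⟨hgF, s, hs, hsg⟩
    rw [Finset.mem_coe, Finset.mem_union, Finset.mem_image, Finset.mem_image]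
    by_cases h : ∀ v ∈ A f, v ≤ s
    · exact Or.inl ⟨f, hfR, IsGreatest.csSup_eq ⟨⟨hs, hsf⟩, h⟩⟩
    · refine Or.inr ⟨g, hgR, IsLeast.csInf_eq ⟨⟨hs, hsg⟩, fun u hu => ?_⟩⟩
      push Not at h
      obtain ⟨v, hv, hsv⟩ := h
      by_contra! hus
      exact (hF f hfF).not_recross (hF g hgF) hfg (hf.mono fun u hu => hu g hgF)
        (hg.mono fun u hu => hu f hfF) hus hsv (hu.2 f hfF) (hv.2 g hgF)
  refine (Set.encard_le_encard key).trans ?_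
  rw [Set.encard_coe_eq_coe_finsetCard]
  refine Nat.cast_le.2 ((Finset.card_union_le _ _).trans ?_)
  have h1 := Finset.card_image_le (s := R) (f := fun f => sSup (A f))
  have h2 := Finset.card_image_le (s := R) (f := fun f => sInf (A f))
  omega

theorem exists_eq_of_mem_envelopeMembers {F : Finset (ℝ → ℝ)} (hF : ∀ f ∈ F, IsQuad f) {a b : ℝ}
    {f g : ℝ → ℝ} (hf : f ∈ envelopeMembers F a b) (hg : g ∈ envelopeMembers F a b) :
    ∃ s ∈ Ioo a b, f s = g s := by
  classical
  obtain ⟨hfF, u, hu, hfu⟩ := Finset.mem_filter.1 hf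
  obtain ⟨hgF, v, hv, hgv⟩ := Finset.mem_filter.1 hg
  have hcf := (hF f hfF).continuous
  have hcg := (hF g hgF).continuous
  rcases le_total u v with h | h
  · obtain ⟨z, hz, he⟩ := exists_eq_of_le_of_ge hcf hcg h (hfu g hgF) (hgv f hfF)
    exact ⟨z, ⟨hu.1.trans_le hz.1, hz.2.trans_lt hv.2⟩, he⟩
  · obtain ⟨z, hz, he⟩ := exists_eq_of_le_of_ge hcg hcf h (hgv f hfF) (hfu g hgF)
    exact ⟨z, ⟨hv.1.trans_le hz.1, hz.2.trans_lt hu.2⟩, he.symm⟩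

/-- `h` agrees with a quadratic in a neighbourhood of `s`. -/
def QuadAt (h : ℝ → ℝ) (s : ℝ) : Prop :=
  ∃ f, IsQuad f ∧ h =ᶠ[𝓝 s] f

/-- A function that is locally quadratic on an interval is a single quadratic there. -/
theorem exists_isQuad_eqOn_Ioo {h : ℝ → ℝ} {a b : ℝ} (hab : a < b)
    (hq : ∀ s ∈ Ioo a b, QuadAt h s) : ∃ f, IsQuad f ∧ EqOn h f (Ioo a b) := by
  obtain ⟨s, hs⟩ := exists_between hab
  obtain ⟨f, hf, hfs⟩ := hq s hs
  refine ⟨f, hf, AnalyticOnNhd.eqOn_of_preconnected_of_eventuallyEq ?_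
    (fun u _ => hf.analyticAt u) isPreconnected_Ioo hs hfs⟩
  intro u hu
  obtain ⟨g, hg, hgu⟩ := hq u hu
  exact (hg.analyticAt u).congr hgu.symm

/-! ### Counting, and subdivisions of an interval -/

theorem encard_iUnion_le_sum {ι α : Type*} [Fintype ι] {s : ι → Set α} {k : ι → ℕ}
    (h : ∀ i, (s i).encard ≤ k i) : (⋃ i, s i).encard ≤ (∑ i, k i : ℕ) := by
  classical
  have hfin : ∀ i, (s i).Finite := fun i => Set.finite_of_encard_le_coe (h i)
  have heq : (⋃ i, s i) = (Finset.univ.biUnion fun i => (hfin i).toFinset : Finset α) := by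
    ext; simp
  rw [heq, Set.encard_coe_eq_coe_finsetCard]
  refine Nat.cast_le.2 (Finset.card_biUnion_le.trans (Finset.sum_le_sum fun i _ => ?_))
  have := h i
  rwa [(hfin i).encard_eq_coe_toFinset_card, Nat.cast_le] at this

theorem encard_iUnion_le_card_mul {ι α : Type*} [Fintype ι] {s : ι → Set α} {k : ℕ}
    (h : ∀ i, (s i).encard ≤ k) : (⋃ i, s i).encard ≤ (Fintype.card ι * k : ℕ) := by
  simpa using encard_iUnion_le_sum h

theorem exists_lt_mem_Ico {f : ℕ → ℝ} {N : ℕ} {s : ℝ} (h0 : f 0 ≤ s) (hN : s < f N) :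
    ∃ i < N, s ∈ Ico (f i) (f (i + 1)) := by
  induction N with
  | zero => exact absurd hN h0.not_gt
  | succ N ih =>
    rcases lt_or_ge s (f N) with h | h
    · obtain ⟨i, hi, hs⟩ := ih h
      exact ⟨i, by omega, hs⟩
    · exact ⟨N, by omega, h, hN⟩

/-- The points of a finite set `F` between its extreme points `a` and `b`, listed in increasing
order. -/
theorem exists_partition {F : Finset ℝ} {a b : ℝ} (ha : a ∈ F) (hb : b ∈ F)
    (hF : ∀ x ∈ F, x ∈ Icc a b) :
    ∃ (N : ℕ) (e : ℕ → ℝ), N + 1 = F.card ∧ e 0 = a ∧ e N = b ∧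
      (∀ i ≤ N, e i ∈ F) ∧ (∀ i < N, e i < e (i + 1)) ∧
      ∀ i < N, ∀ x ∈ F, x ∉ Ioo (e i) (e (i + 1)) := by
  obtain ⟨N, hN⟩ : ∃ N, F.card = N + 1 :=
    Nat.exists_eq_succ_of_ne_zero (Finset.card_ne_zero_of_mem ha)
  let o := F.orderIsoOfFin hN
  let e : ℕ → ℝ := fun i => if h : i < N + 1 then (o ⟨i, h⟩ : ℝ) else 0
  have he : ∀ i (h : i < N + 1), e i = o ⟨i, h⟩ := fun i h => dif_pos h
  have hmem : ∀ i ≤ N, e i ∈ F := fun i hi => by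
    rw [he i (by omega)]; exact (o _).2
  have hsurj : ∀ x ∈ F, ∃ i, ∃ h : i < N + 1, x = o ⟨i, h⟩ := fun x hx =>
    ⟨(o.symm ⟨x, hx⟩).1, (o.symm ⟨x, hx⟩).2, by simp⟩
  refine ⟨N, e, hN.symm, ?_, ?_, hmem, ?_, ?_⟩
  · obtain ⟨i, hi, hx⟩ := hsurj a ha
    refine le_antisymm ?_ (hF _ (hmem 0 (by omega))).1
    rw [hx, he 0 (by omega), Subtype.coe_le_coe, o.le_iff_le, Fin.mk_le_mk]
    omega
  · obtain ⟨i, hi, hx⟩ := hsurj b hb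
    refine le_antisymm (hF _ (hmem N le_rfl)).2 ?_
    rw [hx, he N (by omega), Subtype.coe_le_coe, o.le_iff_le, Fin.mk_le_mk]
    omega
  · intro i hi
    rw [he i (by omega), he (i + 1) (by omega), Subtype.coe_lt_coe, o.lt_iff_lt, Fin.mk_lt_mk]
    omega
  · rintro i hi x hx ⟨h1, h2⟩
    obtain ⟨j, hj, rfl⟩ := hsurj x hx
    rw [he i (by omega), Subtype.coe_lt_coe, o.lt_iff_lt, Fin.mk_lt_mk] at h1
    rw [he (i + 1) (by omega), Subtype.coe_lt_coe, o.lt_iff_lt, Fin.mk_lt_mk] at h2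
    omega

theorem exists_mem_gap {F : Finset ℝ} {N : ℕ} {e : ℕ → ℝ} (he : ∀ i ≤ N, e i ∈ F) {s : ℝ}
    (hs : s ∈ Icc (e 0) (e N)) (hsF : s ∉ F) : ∃ i < N, s ∈ Ioo (e i) (e (i + 1)) := by
  have hne : ∀ i ≤ N, s ≠ e i := fun i hi h => hsF (h ▸ he i hi)
  obtain ⟨i, hi, h⟩ := exists_lt_mem_Ico hs.1 (hs.2.lt_of_ne (hne N le_rfl))
  exact ⟨i, hi, h.1.lt_of_ne (hne i hi.le).symm, h.2⟩

theorem lt_of_lt_succ {N : ℕ} {e : ℕ → ℝ} (he : ∀ i < N, e i < e (i + 1)) {i j : ℕ} (hij : i < j)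
    (hj : j ≤ N) : e i < e j := by
  induction j, hij using Nat.le_induction with
  | base => exact he i (by omega)
  | succ j _ ih => exact (ih (by omega)).trans (he j (by omega))

theorem le_of_lt_succ {N : ℕ} {e : ℕ → ℝ} (he : ∀ i < N, e i < e (i + 1)) {i j : ℕ} (hij : i ≤ j)
    (hj : j ≤ N) : e i ≤ e j :=
  hij.eq_or_lt.elim (fun h => h ▸ le_rfl) fun h => (lt_of_lt_succ he h hj).le

theorem gap_injective {N : ℕ} {e : ℕ → ℝ} (he : ∀ i < N, e i < e (i + 1)) {i j : ℕ} (hi : i < N)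
    (hj : j < N) {x : ℝ} (hxi : x ∈ Ioo (e i) (e (i + 1))) (hxj : x ∈ Ioo (e j) (e (j + 1))) :
    i = j := by
  by_contra hne
  rcases Nat.lt_or_gt_of_ne hne with h | h
  · exact absurd (hxi.2.trans_le (le_of_lt_succ he h hj.le)) hxj.1.not_gt
  · exact absurd (hxj.2.trans_le (le_of_lt_succ he h hi.le)) hxi.1.not_gt

/-! ### Distances, costs and trajectoids -/

namespace MovingEntities

section Basics

variable {d n τ : ℕ} {X : MovingEntities d n τ} {ε : ℝ}

theorem time_mem_span (j : Fin (τ + 1)) : X.time j ∈ X.span :=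
  ⟨X.time_strictMono.monotone (Fin.zero_le j), X.time_strictMono.monotone (Fin.le_last j)⟩

theorem time_zero_le_last : X.time 0 ≤ X.time (Fin.last τ) :=
  (time_mem_span 0).2

theorem time_zero_lt_last (hτ : 1 ≤ τ) : X.time 0 < X.time (Fin.last τ) :=
  X.time_strictMono (by rw [Fin.lt_def]; exact hτ)

theorem exists_mem_edge (hτ : 1 ≤ τ) {s : ℝ} (hs : s ∈ X.span) :
    ∃ i : Fin τ, s ∈ Icc (X.time i.castSucc) (X.time i.succ) := by
  rcases hs.2.eq_or_lt with h | h
  · obtain ⟨k, rfl⟩ : ∃ k, τ = k + 1 := ⟨τ - 1, by omega⟩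
    refine ⟨Fin.last k, ?_, ?_⟩
    · rw [h]
      exact X.time_strictMono.monotone (Fin.le_last _)
    · rw [Fin.succ_last]
      exact h.le
  · obtain ⟨i, hi, h1, h2⟩ := exists_lt_mem_Ico (N := τ) (s := s)
      (f := fun i => if h : i < τ + 1 then X.time ⟨i, h⟩ else 0)
      (by simpa using hs.1) (by simpa [Fin.last] using h)
    rw [dif_pos (by omega)] at h1
    rw [dif_pos (by omega)] at h2
    exact ⟨⟨i, hi⟩, h1, h2.le⟩

theorem time_castSucc_lt_succ (i : Fin τ) : X.time i.castSucc < X.time i.succ :=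
  X.time_strictMono Fin.castSucc_lt_succ

theorem exists_mem_open_edge (hτ : 1 ≤ τ) {s : ℝ} (hs : s ∈ X.span) (hst : s ∉ range X.time) :
    ∃ i : Fin τ, s ∈ Ioo (X.time i.castSucc) (X.time i.succ) := by
  obtain ⟨i, hi⟩ := exists_mem_edge hτ hs
  exact ⟨i, hi.1.lt_of_ne fun h => hst ⟨_, h⟩, hi.2.lt_of_ne fun h => hst ⟨_, h.symm⟩⟩

/-- Along one edge, squared distances are quadratic in time. -/
theorem exists_isQuad_sq_dist (X : MovingEntities d n τ) (i : Fin τ) (σ ψ : Fin n) :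
    ∃ f, IsQuad f ∧ ∀ s ∈ Icc (X.time i.castSucc) (X.time i.succ),
      dist (X.pos σ s) (X.pos ψ s) ^ 2 = f s := by
  set a := X.time i.castSucc
  set b := X.time i.succ
  have hab : b - a ≠ 0 := (sub_pos.2 (time_castSucc_lt_succ i)).ne'
  set v := X.pos σ a - X.pos ψ a
  set w := (X.pos σ b - X.pos ψ b) - v
  refine ⟨fun s => ‖v‖ ^ 2 + 2 * ((s - a) / (b - a) * inner ℝ v w)
    + ((s - a) / (b - a)) ^ 2 * ‖w‖ ^ 2, ?_, fun s hs => ?_⟩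
  · refine ⟨‖w‖ ^ 2 / (b - a) ^ 2,
      2 * inner ℝ v w / (b - a) - 2 * a * ‖w‖ ^ 2 / (b - a) ^ 2,
      ‖v‖ ^ 2 - 2 * a * inner ℝ v w / (b - a) + a ^ 2 * ‖w‖ ^ 2 / (b - a) ^ 2, fun u => ?_⟩
    field_simp
    ring
  · have h : X.pos σ s - X.pos ψ s = v + ((s - a) / (b - a)) • w := by
      rw [X.pos_linear σ i s hs, X.pos_linear ψ i s hs, AffineMap.lineMap_apply_module,
        AffineMap.lineMap_apply_module]
      simp only [v, w]
      module
    rw [dist_eq_norm, h, norm_add_sq_real, inner_smul_right, norm_smul, mul_pow, Real.norm_eq_abs,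
      sq_abs]

theorem continuousOn_pos (hτ : 1 ≤ τ) (X : MovingEntities d n τ) (σ : Fin n) :
    ContinuousOn (X.pos σ) X.span := by
  have h : ContinuousOn (X.pos σ)
      (⋃ i : Fin τ, Icc (X.time i.castSucc) (X.time i.succ)) := by
    refine LocallyFinite.continuousOn_iUnion (locallyFinite_of_finite _)
      (fun i => isClosed_Icc) fun i => ?_
    refine ContinuousOn.congr ?_ (X.pos_linear σ i)
    exact (AffineMap.lineMap_continuous.comp
      (by fun_prop : Continuous fun s => (s - X.time i.castSucc) /
        (X.time i.succ - X.time i.castSucc))).continuousOn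
  exact h.mono fun s hs => mem_iUnion.2 (exists_mem_edge hτ hs)

theorem continuousOn_dist_pos (hτ : 1 ≤ τ) (X : MovingEntities d n τ) (σ ψ : Fin n) :
    ContinuousOn (fun s => dist (X.pos σ s) (X.pos ψ s)) X.span := fun s hs =>
  Filter.Tendsto.dist (continuousOn_pos hτ X σ s hs) (continuousOn_pos hτ X ψ s hs)

theorem dist_le_farDist (σ ψ : Fin n) (s : ℝ) : dist (X.pos σ s) (X.pos ψ s) ≤ X.farDist σ s :=
  le_ciSup (f := fun ψ => dist (X.pos σ s) (X.pos ψ s)) (finite_range _).bddAbove ψ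

theorem farDist_nonneg (σ : Fin n) (s : ℝ) : 0 ≤ X.farDist σ s :=
  dist_nonneg.trans (dist_le_farDist σ σ s)

theorem farDist_le_iff_sq_le {σ ψ : Fin n} {s : ℝ} :
    X.farDist σ s ≤ X.farDist ψ s ↔ X.farDist σ s ^ 2 ≤ X.farDist ψ s ^ 2 :=
  (sq_le_sq₀ (farDist_nonneg σ s) (farDist_nonneg ψ s)).symm

theorem farDist_eq_dist {σ ψ : Fin n} {s : ℝ}
    (h : ∀ χ, dist (X.pos σ s) (X.pos χ s) ≤ dist (X.pos σ s) (X.pos ψ s)) :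
    X.farDist σ s = dist (X.pos σ s) (X.pos ψ s) :=
  haveI : Nonempty (Fin n) := ⟨σ⟩
  le_antisymm (ciSup_le h) (dist_le_farDist σ ψ s)

theorem continuousOn_farDist (hτ : 1 ≤ τ) (X : MovingEntities d n τ) (σ : Fin n) :
    ContinuousOn (X.farDist σ) X.span := by
  have hne : (Finset.univ : Finset (Fin n)).Nonempty := ⟨σ, Finset.mem_univ σ⟩
  have heq : X.farDist σ = fun s => Finset.univ.sup' hne fun ψ => dist (X.pos σ s) (X.pos ψ s) := by
    funext s
    have : Nonempty (Fin n) := ⟨σ⟩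
    exact (Finset.sup'_univ_eq_ciSup _).symm
  rw [heq]
  exact ContinuousOn.finset_sup'_apply hne fun ψ _ =>
    continuousOn_dist_pos hτ X σ ψ

theorem integrableOn_farDist (hτ : 1 ≤ τ) (X : MovingEntities d n τ) {T : ℝ → Fin n}
    (hT : Measurable T) : IntegrableOn (fun u => X.farDist (T u) u) X.span := by
  have heq : (fun u => X.farDist (T u) u) =
      fun u => ∑ σ, (T ⁻¹' {σ}).indicator (X.farDist σ) u := by
    funext u
    rw [Finset.sum_eq_single (T u)]
    · simp
    · intro σ _ h
      exact indicator_of_notMem (fun h' => h h'.symm) _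
    · simp
  rw [heq]
  exact integrable_finsetSum _ fun σ _ => Integrable.indicator
    (continuousOn_farDist hτ X σ).integrableOn_Icc (hT (measurableSet_singleton σ))

theorem cost_eq_setIntegral (T : ℝ → Fin n) : X.cost T = ∫ u in X.span, X.farDist (T u) u := by
  rw [cost, intervalIntegral.integral_of_le time_zero_le_last, span, integral_Icc_eq_integral_Ioc]

theorem cost_le_cost (hτ : 1 ≤ τ) {T T' : ℝ → Fin n} (hT : Measurable T) (hT' : Measurable T')
    (h : ∀ᵐ u, u ∈ X.span → X.farDist (T u) u ≤ X.farDist (T' u) u) : X.cost T ≤ X.cost T' := by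
  rw [cost_eq_setIntegral, cost_eq_setIntegral]
  exact integral_mono_ae (integrableOn_farDist hτ X hT) (integrableOn_farDist hτ X hT')
    ((ae_restrict_iff' measurableSet_Icc).2 h)

theorem ae_eq_of_cost_le (hτ : 1 ≤ τ) {T T' : ℝ → Fin n} (hT : Measurable T) (hT' : Measurable T')
    (h : ∀ᵐ u, u ∈ X.span → X.farDist (T u) u ≤ X.farDist (T' u) u) (hc : X.cost T' ≤ X.cost T) :
    ∀ᵐ u, u ∈ X.span → X.farDist (T u) u = X.farDist (T' u) u := by
  rw [cost_eq_setIntegral, cost_eq_setIntegral] at hc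
  have hi := integrableOn_farDist hτ X hT
  have hi' := integrableOn_farDist hτ X hT'
  have hle : (fun u => X.farDist (T u) u) ≤ᵐ[volume.restrict X.span]
      fun u => X.farDist (T' u) u :=
    (ae_restrict_iff' measurableSet_Icc).2 h
  exact (ae_restrict_iff' measurableSet_Icc).1 <|
    (integral_eq_iff_of_ae_le hi hi' hle).1 (le_antisymm (integral_mono_ae hi hi' hle) hc)

theorem exists_mem_Ioo_of_ae {P : ℝ → Prop} (h : ∀ᵐ u, u ∈ X.span → P u) {p q : ℝ} (hpq : p < q)
    (hs : Ioo p q ⊆ X.span) : ∃ u ∈ Ioo p q, P u := by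
  by_contra! hcon
  have h0 : volume (Ioo p q) = 0 :=
    measure_mono_null (fun u hu => fun h' => hcon u hu (h' (hs hu))) (ae_iff.1 h)
  rw [Real.volume_Ioo, ENNReal.ofReal_eq_zero] at h0
  linarith

theorem EpsConnected.refl (σ : Fin n) (s : ℝ) : X.EpsConnected ε s σ σ :=
  Relation.ReflTransGen.refl

theorem EpsConnected.symm {s : ℝ} {σ ψ : Fin n} (h : X.EpsConnected ε s σ ψ) :
    X.EpsConnected ε s ψ σ := by
  have : Std.Symm fun a b => dist (X.pos a s) (X.pos b s) ≤ ε :=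
    ⟨fun a b h => by rwa [dist_comm]⟩
  exact Relation.ReflTransGen.stdSymm.symm _ _ h

theorem EpsConnected.trans {s : ℝ} {σ ψ χ : Fin n} (h : X.EpsConnected ε s σ ψ)
    (h' : X.EpsConnected ε s ψ χ) : X.EpsConnected ε s σ χ :=
  Relation.ReflTransGen.trans h h'

/-- The condition on the jumps of a trajectoid as a single eventual statement; the quantifier over
the values may be moved inside as there are finitely many entities. -/
theorem isTrajectoid_iff {T : ℝ → Fin n} : X.IsTrajectoid ε T ↔
    Measurable T ∧ ∀ s ∈ X.span, ∀ᶠ u in 𝓝[X.span] s, X.EpsConnected ε s (T s) (T u) := by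
  refine and_congr_right fun _ => forall₂_congr fun s _ => ⟨fun h => ?_, fun h ψ hψ => ?_⟩
  · have : ∀ᶠ u in 𝓝[X.span] s, ∀ ψ, T u = ψ → X.EpsConnected ε s (T s) ψ := by
      refine eventually_all.2 fun ψ => ?_
      by_cases hψ : ∃ᶠ u in 𝓝[X.span] s, T u = ψ
      · exact Eventually.of_forall fun u _ => h ψ hψ
      · filter_upwards [not_frequently.1 hψ] with u hu hu'
        exact absurd hu' hu
    exact this.mono fun u hu => hu _ rfl
  · obtain ⟨u, rfl, hu⟩ := (hψ.and_eventually h).exists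
    exact hu

/-! ### Gaps: time intervals with fixed `ε`-connections -/

/-- `(a, b)` is a time interval during which the pairs of entities at distance at most `ε` do not
change. -/
structure IsGap (X : MovingEntities d n τ) (ε a b : ℝ) : Prop where
  lt : a < b
  left_mem : a ∈ X.span
  right_mem : b ∈ X.span
  const : ∀ σ ψ : Fin n, ∀ u ∈ Ioo a b, ∀ v ∈ Ioo a b,
    dist (X.pos σ u) (X.pos ψ u) ≤ ε → dist (X.pos σ v) (X.pos ψ v) ≤ ε

namespace IsGap

variable {a b : ℝ}

theorem Icc_subset (hg : X.IsGap ε a b) : Icc a b ⊆ X.span :=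
  Icc_subset_Icc hg.left_mem.1 hg.right_mem.2

theorem Ioo_subset (hg : X.IsGap ε a b) : Ioo a b ⊆ X.span :=
  Ioo_subset_Icc_self.trans hg.Icc_subset

/-- Being within distance `ε` is a closed condition, so connections during a gap persist at its end
points. -/
theorem epsConnected (hτ : 1 ≤ τ) (hg : X.IsGap ε a b) {u v : ℝ} (hu : u ∈ Ioo a b)
    (hv : v ∈ Icc a b) {σ ψ : Fin n} (h : X.EpsConnected ε u σ ψ) : X.EpsConnected ε v σ ψ := by
  refine Relation.ReflTransGen.mono (fun σ ψ h => ?_) _ _ h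
  have hcl : v ∈ closure (Ioo a b) := by rwa [closure_Ioo hg.lt.ne]
  have hsub := hg.Ioo_subset
  have hc := (continuousOn_dist_pos hτ X σ ψ).mono hsub
  have hc' : ContinuousWithinAt (fun x => dist (X.pos σ x) (X.pos ψ x)) (Ioo a b) v :=
    (continuousOn_dist_pos hτ X σ ψ v (hg.Icc_subset hv)).mono hsub
  exact ContinuousWithinAt.closure_le hcl hc' continuousWithinAt_const
    fun y hy => hg.const σ ψ u hu y hy h

/-- During a gap a trajectoid stays in one component. -/
theorem epsConnected_apply (hτ : 1 ≤ τ) (hg : X.IsGap ε a b) {T : ℝ → Fin n}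
    (hT : X.IsTrajectoid ε T) {u v w : ℝ} (hu : u ∈ Ioo a b) (hv : v ∈ Ioo a b)
    (hw : w ∈ Icc a b) : X.EpsConnected ε w (T u) (T v) := by
  rw [isTrajectoid_iff] at hT
  refine isPreconnected_Ioo.induction₂ (fun x y => X.EpsConnected ε w (T x) (T y))
    (fun x hx => ?_) (fun x y z _ _ _ => EpsConnected.trans) (fun x y _ _ => EpsConnected.symm)
    hu hv
  filter_upwards [(hT.2 x (hg.Ioo_subset hx)).filter_mono (nhdsWithin_mono _ hg.Ioo_subset)]
    with y hy
  exact hg.epsConnected hτ hx hw hy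

/-- Following `ψ` on a part of a gap during which `ψ` is in the component visited. At the end
points of the gap this works because connections persist there. -/
theorem isTrajectoid_follow (hτ : 1 ≤ τ) (hg : X.IsGap ε a b) {T : ℝ → Fin n}
    (hT : X.IsTrajectoid ε T) {I : Set ℝ} (hI : MeasurableSet I) (hab : I ⊆ Ioo a b) {ψ : Fin n}
    (hψ : ∀ u ∈ I, X.EpsConnected ε u (T u) ψ) : X.IsTrajectoid ε (follow T I ψ) := by
  classical
  rw [isTrajectoid_iff] at hT ⊢
  refine ⟨?_, fun s hs => ?_⟩
  · unfold follow
    exact Measurable.ite hI measurable_const hT.1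
  have h1 : X.EpsConnected ε s (follow T I ψ s) (T s) := by
    by_cases hsI : s ∈ I
    · simpa [follow, hsI] using (hψ s hsI).symm
    · simpa [follow, hsI] using EpsConnected.refl _ _
  have h2 : ∀ᶠ u in 𝓝[X.span] s, u ∈ I → s ∈ Icc a b := by
    by_cases hsI : s ∈ Icc a b
    · exact Eventually.of_forall fun _ _ => hsI
    · filter_upwards [nhdsWithin_le_nhds (isClosed_Icc.isOpen_compl.mem_nhds hsI)] with u hu huI
      exact absurd (Ioo_subset_Icc_self (hab huI)) hu
  filter_upwards [hT.2 s hs, h2] with u hu hu2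
  refine h1.trans (hu.trans ?_)
  by_cases huI : u ∈ I
  · simpa [follow, huI] using hg.epsConnected hτ (hab huI) (hu2 huI) (hψ u huI)
  · simpa [follow, huI] using EpsConnected.refl _ _

end IsGap

end Basics

end MovingEntities

/-! ### Cuts and crossings -/

namespace MovingEntities

section Cuts

variable {d n τ : ℕ} {X : MovingEntities d n τ} {ε : ℝ}

/-- The square of `D(σ, ·)`; along an edge it is the upper envelope of `n` quadratics. -/
noncomputable def sqFarDist (X : MovingEntities d n τ) (σ : Fin n) (s : ℝ) : ℝ :=
  X.farDist σ s ^ 2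

/-- The times inside the edges at which `D(σ, ·)²` passes from one quadratic to another. -/
def shapeBreaks (X : MovingEntities d n τ) (σ : Fin n) : Set ℝ :=
  {s | s ∈ X.span ∧ s ∉ range X.time ∧ ¬ QuadAt (X.sqFarDist σ) s}

/-- The times inside the edges at which `σ` and `ψ` come within distance `ε` of each other or
cease to be so. -/
def linkBreaks (X : MovingEntities d n τ) (ε : ℝ) (σ ψ : Fin n) : Set ℝ :=
  {s | s ∈ X.span ∧ s ∉ range X.time ∧ ¬ ∀ᶠ u in 𝓝 s,
    (dist (X.pos σ u) (X.pos ψ u) ≤ ε ↔ dist (X.pos σ s) (X.pos ψ s) ≤ ε)}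

/-- The times between which all entities move linearly, all `D(σ, ·)²` are quadratic, and
`ε`-connectedness does not change. -/
def cuts (X : MovingEntities d n τ) (ε : ℝ) : Set ℝ :=
  range X.time ∪ ((⋃ σ, X.shapeBreaks σ) ∪ ⋃ p : Fin n × Fin n, X.linkBreaks ε p.1 p.2)

/-- The times at which `D(σ, ·)` and `D(ψ, ·)` meet without coinciding around that time. The
vertex times and the times at which one of the two squares passes to another quadratic are left
out: they are cuts anyway. -/
def crossings (X : MovingEntities d n τ) (σ ψ : Fin n) : Set ℝ :=
  {s | s ∈ X.span ∧ s ∉ range X.time ∪ (X.shapeBreaks σ ∪ X.shapeBreaks ψ) ∧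
    X.sqFarDist σ s = X.sqFarDist ψ s ∧ ¬ X.sqFarDist σ =ᶠ[𝓝 s] X.sqFarDist ψ}

theorem encard_range_time_le (X : MovingEntities d n τ) :
    (range X.time).encard ≤ (τ + 1 : ℕ) := by
  rw [← image_univ]
  refine (encard_image_le _ _).trans ?_
  simp

theorem encard_shapeBreaks_le (hτ : 1 ≤ τ) (X : MovingEntities d n τ) (σ : Fin n) :
    (X.shapeBreaks σ).encard ≤ (τ * (2 * n) : ℕ) := by
  classical
  choose Q hQ hQd using fun i ψ => X.exists_isQuad_sq_dist i σ ψ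
  -- The upper envelope of the `Q i ψ` is minus the lower envelope of their negatives.
  let F : Fin τ → Finset (ℝ → ℝ) := fun i => Finset.univ.image fun ψ => -Q i ψ
  have hF : ∀ i, ∀ f ∈ F i, IsQuad f := fun i f hf => by
    obtain ⟨ψ, -, rfl⟩ := Finset.mem_image.1 hf
    exact (hQ i ψ).neg
  have hne : ∀ i, (F i).Nonempty := fun i => ⟨-Q i σ, Finset.mem_image_of_mem _ (Finset.mem_univ σ)⟩
  have hsub : X.shapeBreaks σ ⊆
      ⋃ i : Fin τ, envelopeBreaks (F i) (X.time i.castSucc) (X.time i.succ) := by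
    rintro s ⟨hs, hst, hq⟩
    obtain ⟨i, hi⟩ := exists_mem_open_edge hτ hs hst
    refine mem_iUnion.2 ⟨i, hi, ?_⟩
    rintro ⟨f, hf, hmin⟩
    obtain ⟨ψ, -, rfl⟩ := Finset.mem_image.1 hf
    refine hq ⟨Q i ψ, hQ i ψ, ?_⟩
    filter_upwards [hmin, Ioo_mem_nhds hi.1 hi.2] with u hu hui
    have hui' := Ioo_subset_Icc_self hui
    rw [sqFarDist, farDist_eq_dist (ψ := ψ), hQd i ψ u hui']
    intro χ
    rw [← sq_le_sq₀ dist_nonneg dist_nonneg, hQd i ψ u hui', hQd i χ u hui']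
    exact neg_le_neg_iff.1 (hu _ (Finset.mem_image_of_mem _ (Finset.mem_univ χ)))
  refine (encard_le_encard hsub).trans ?_
  have := encard_iUnion_le_card_mul (k := 2 * n)
    (s := fun i : Fin τ => envelopeBreaks (F i) (X.time i.castSucc) (X.time i.succ)) fun i => ?_
  · simpa using this
  · refine (encard_envelopeBreaks_le (hF i) (hne i) _ _).trans (Nat.cast_le.2 ?_)
    refine Nat.mul_le_mul_left 2 ((Finset.card_filter_le _ _).trans ?_)
    exact Finset.card_image_le.trans (by simp)

theorem encard_linkBreaks_le (hτ : 1 ≤ τ) (X : MovingEntities d n τ) (ε : ℝ) (σ ψ : Fin n) :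
    (X.linkBreaks ε σ ψ).encard ≤ (τ * 2 : ℕ) := by
  choose Q hQ hQd using fun i => X.exists_isQuad_sq_dist i σ ψ
  have hsub : X.linkBreaks ε σ ψ ⊆
      ⋃ i : Fin τ, {s | (fun u => Q i u - ε ^ 2) s = 0 ∧ (fun u => Q i u - ε ^ 2) ≠ 0} := by
    rintro s ⟨hs, hst, hq⟩
    obtain ⟨i, hi⟩ := exists_mem_open_edge hτ hs hst
    have hε : 0 ≤ ε := by
      by_contra! h
      refine hq (Eventually.of_forall fun u => ?_)
      exact iff_of_false (not_le.2 (h.trans_le dist_nonneg)) (not_le.2 (h.trans_le dist_nonneg))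
    have hiff : ∀ u ∈ Ioo (X.time i.castSucc) (X.time i.succ),
        (dist (X.pos σ u) (X.pos ψ u) ≤ ε ↔ Q i u ≤ ε ^ 2) := fun u hu => by
      rw [← hQd i u (Ioo_subset_Icc_self hu), sq_le_sq₀ dist_nonneg hε]
    have hnhds := Ioo_mem_nhds hi.1 hi.2
    have hc := (hQ i).continuous.continuousAt (x := s)
    refine mem_iUnion.2 ⟨i, ?_, fun h0 => hq ?_⟩
    · rcases lt_trichotomy (Q i s) (ε ^ 2) with h | h | h
      · refine absurd ?_ hq
        filter_upwards [hnhds, hc.eventually_lt continuousAt_const h] with u hu hlt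
        rw [hiff u hu, hiff s hi]
        exact iff_of_true hlt.le h.le
      · exact sub_eq_zero.2 h
      · refine absurd ?_ hq
        filter_upwards [hnhds, continuousAt_const.eventually_lt hc h] with u hu hlt
        rw [hiff u hu, hiff s hi]
        exact iff_of_false hlt.not_ge h.not_ge
    · filter_upwards [hnhds] with u hu
      rw [hiff u hu, hiff s hi, sub_eq_zero.1 (congrFun h0 u), sub_eq_zero.1 (congrFun h0 s)]
  refine (encard_le_encard hsub).trans ?_
  have := encard_iUnion_le_card_mul (k := 2)
    (s := fun i : Fin τ => {s | (fun u => Q i u - ε ^ 2) s = 0 ∧ (fun u => Q i u - ε ^ 2) ≠ 0})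
    fun i => ?_
  · simpa using this
  · by_cases h0 : (fun u => Q i u - ε ^ 2) = 0
    · simp [h0]
    · exact (encard_le_encard fun s hs => hs.1).trans (((hQ i).sub_const _).encard_zeros_le h0)

theorem encard_cuts_le (hn : 1 ≤ n) (hτ : 1 ≤ τ) (X : MovingEntities d n τ) (ε : ℝ) :
    (X.cuts ε).encard ≤ (6 * τ * n ^ 2 : ℕ) := by
  have h1 := encard_iUnion_le_card_mul fun σ => encard_shapeBreaks_le hτ X σ
  have h2 := encard_iUnion_le_card_mul fun p : Fin n × Fin n =>
    encard_linkBreaks_le hτ X ε p.1 p.2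
  refine (encard_union_le _ _).trans ((add_le_add (encard_range_time_le X)
    ((encard_union_le _ _).trans (add_le_add h1 h2))).trans ?_)
  rw [← Nat.cast_add, ← Nat.cast_add, Nat.cast_le]
  simp only [Fintype.card_fin, Fintype.card_prod]
  have : τ * 1 ≤ τ * n ^ 2 := Nat.mul_le_mul_left _ (Nat.one_le_pow _ _ hn)
  nlinarith

theorem finite_cuts (hn : 1 ≤ n) (hτ : 1 ≤ τ) (X : MovingEntities d n τ) (ε : ℝ) :
    (X.cuts ε).Finite :=
  finite_of_encard_le_coe (encard_cuts_le hn hτ X ε)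

theorem cuts_subset_span : X.cuts ε ⊆ X.span := by
  rintro s (⟨j, rfl⟩ | hs | hs)
  · exact time_mem_span j
  · exact (mem_iUnion.1 hs).choose_spec.1
  · exact (mem_iUnion.1 hs).choose_spec.1

/-- Between the `O(τ n)` times at which `D(σ, ·)²` or `D(ψ, ·)²` changes its quadratic, the two
quadratics coincide or meet at most twice. -/
theorem encard_crossings_le (hn : 1 ≤ n) (hτ : 1 ≤ τ) (X : MovingEntities d n τ) (σ ψ : Fin n) :
    (X.crossings σ ψ).encard ≤ (12 * τ * n : ℕ) := by
  set E := range X.time ∪ (X.shapeBreaks σ ∪ X.shapeBreaks ψ) with hE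
  have hcard : E.encard ≤ (6 * τ * n : ℕ) := by
    refine (encard_union_le _ _).trans ((add_le_add (encard_range_time_le X)
      ((encard_union_le _ _).trans (add_le_add (encard_shapeBreaks_le hτ X σ)
        (encard_shapeBreaks_le hτ X ψ)))).trans ?_)
    rw [← Nat.cast_add, ← Nat.cast_add, Nat.cast_le]
    have : τ * 1 ≤ τ * n := Nat.mul_le_mul_left _ hn
    nlinarith
  have hfin : E.Finite := finite_of_encard_le_coe hcard
  rw [hfin.encard_eq_coe_toFinset_card, Nat.cast_le] at hcard
  have hspan : E ⊆ X.span := by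
    rintro s (⟨j, rfl⟩ | hs | hs)
    exacts [time_mem_span j, hs.1, hs.1]
  obtain ⟨N, e, hN, he0, heN, heE, hlt, hgap⟩ := exists_partition (F := hfin.toFinset)
    (a := X.time 0) (b := X.time (Fin.last τ)) (by simp [hE]) (by simp [hE])
    (fun x hx => hspan (hfin.mem_toFinset.1 hx))
  have hsub : X.crossings σ ψ ⊆ ⋃ i : Fin N, X.crossings σ ψ ∩ Ioo (e i) (e (i + 1)) := by
    intro s hs
    obtain ⟨i, hi, hsi⟩ := exists_mem_gap heE (s := s) (by rw [he0, heN]; exact hs.1)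
      (fun h => hs.2.1 (hfin.mem_toFinset.1 h))
    exact mem_iUnion.2 ⟨⟨i, hi⟩, hs, hsi⟩
  refine (encard_le_encard hsub).trans ((encard_iUnion_le_card_mul (k := 2) fun i => ?_).trans ?_)
  · have hsp : Ioo (e i) (e (i + 1)) ⊆ X.span := fun u hu =>
      ⟨(hspan (hfin.mem_toFinset.1 (heE i i.2.le))).1.trans hu.1.le,
        hu.2.le.trans (hspan (hfin.mem_toFinset.1 (heE (i + 1) i.2))).2⟩
    have hE' : ∀ u ∈ Ioo (e i) (e (i + 1)), u ∉ E := fun u hu huE =>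
      hgap i i.2 u (hfin.mem_toFinset.2 huE) hu
    have hq : ∀ χ, X.shapeBreaks χ ⊆ E →
        ∃ f, IsQuad f ∧ EqOn (X.sqFarDist χ) f (Ioo (e i) (e (i + 1))) := fun χ hχ =>
      exists_isQuad_eqOn_Ioo (hlt i i.2) fun u hu => by
        by_contra h
        exact hE' u hu (hχ ⟨hsp hu, fun h => hE' u hu (Or.inl h), h⟩)
    obtain ⟨f, hf, hfe⟩ := hq σ fun u hu => Or.inr (Or.inl hu)
    obtain ⟨g, hg, hge⟩ := hq ψ fun u hu => Or.inr (Or.inr hu)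
    by_cases hfg : f = g
    · have : X.crossings σ ψ ∩ Ioo (e i) (e (i + 1)) = ∅ := by
        rw [eq_empty_iff_forall_notMem]
        rintro s ⟨hs, hsi⟩
        refine hs.2.2.2 ?_
        filter_upwards [Ioo_mem_nhds hsi.1 hsi.2] with u hu
        rw [hfe hu, hge hu, hfg]
      simp [this]
    · refine (encard_le_encard ?_).trans ((hf.sub hg).encard_zeros_le (sub_ne_zero.2 hfg))
      rintro s ⟨hs, hsi⟩
      exact sub_eq_zero.2 (by rw [← hfe hsi, ← hge hsi, hs.2.2.1])
  · rw [Nat.cast_le, Fintype.card_fin]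
    have : N * 2 ≤ (6 * τ * n) * 2 := by omega
    linarith

theorem isGap_of_disjoint_cuts {a b : ℝ} (hab : a < b) (ha : a ∈ X.span) (hb : b ∈ X.span)
    (h : ∀ u ∈ Ioo a b, u ∉ X.cuts ε) : X.IsGap ε a b := by
  refine ⟨hab, ha, hb, fun σ ψ u hu v hv => ?_⟩
  refine isPreconnected_Ioo.induction₂ (fun x y => (dist (X.pos σ x) (X.pos ψ x) ≤ ε ↔
    dist (X.pos σ y) (X.pos ψ y) ≤ ε)) (fun x hx => ?_) (fun x y z _ _ _ => Iff.trans)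
    (fun x y _ _ => Iff.symm) hu hv |>.1
  have hx' : x ∉ X.linkBreaks ε σ ψ := fun h' =>
    h x hx (Or.inr (Or.inr (mem_iUnion.2 ⟨(σ, ψ), h'⟩)))
  have hxs : x ∈ X.span := ⟨ha.1.trans hx.1.le, hx.2.le.trans hb.2⟩
  by_contra hcon
  exact hx' ⟨hxs, fun h' => h x hx (Or.inl h'),
    fun h' => hcon ((h'.filter_mono nhdsWithin_le_nhds).mono fun _ => Iff.symm)⟩

theorem IsGap.exists_isQuad_eqOn {a b : ℝ} (hg : X.IsGap ε a b) (h : ∀ u ∈ Ioo a b, u ∉ X.cuts ε)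
    (σ : Fin n) : ∃ f, IsQuad f ∧ EqOn (X.sqFarDist σ) f (Ioo a b) := by
  refine exists_isQuad_eqOn_Ioo hg.lt fun u hu => ?_
  by_contra h'
  exact h u hu (Or.inr (Or.inl (mem_iUnion.2
    ⟨σ, hg.Ioo_subset hu, fun ht => h u hu (Or.inl ht), h'⟩)))

/-- Inside a gap without cuts, a common value of two different quadratics is a crossing. -/
theorem mem_crossings_of_eq {a b : ℝ} (hg : X.IsGap ε a b) (h : ∀ u ∈ Ioo a b, u ∉ X.cuts ε)
    {σ ψ : Fin n} {f g : ℝ → ℝ} (hf : IsQuad f) (hgq : IsQuad g)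
    (hfe : EqOn (X.sqFarDist σ) f (Ioo a b)) (hge : EqOn (X.sqFarDist ψ) g (Ioo a b))
    (hfg : f ≠ g) {s : ℝ} (hs : s ∈ Ioo a b) (heq : f s = g s) : s ∈ X.crossings σ ψ := by
  refine ⟨hg.Ioo_subset hs, ?_, ?_, fun hev => ?_⟩
  · rintro (h' | h' | h')
    · exact h s hs (Or.inl h')
    · exact h s hs (Or.inr (Or.inl (mem_iUnion.2 ⟨_, h'⟩)))
    · exact h s hs (Or.inr (Or.inl (mem_iUnion.2 ⟨_, h'⟩)))
  · rw [hfe hs, hge hs, heq]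
  · obtain ⟨u, ⟨hu, hu'⟩, hne⟩ := (((hev.filter_mono nhdsWithin_le_nhds).and
      (nhdsWithin_le_nhds (Ioo_mem_nhds hs.1 hs.2))).and (hf.eventually_ne hgq hfg s)).exists
    exact hne (by rw [← hfe hu', ← hge hu', hu])

/-- Between consecutive cuts and crossings, `D(σ, ·)` and `D(ψ, ·)` coincide or are strictly
ordered. -/
theorem IsGap.farDist_trichotomy {a b : ℝ} (hg : X.IsGap ε a b)
    (h : ∀ u ∈ Ioo a b, u ∉ X.cuts ε) {σ ψ : Fin n} (hc : ∀ u ∈ Ioo a b, u ∉ X.crossings σ ψ) :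
    (∀ u ∈ Ioo a b, X.farDist σ u = X.farDist ψ u) ∨
      (∀ u ∈ Ioo a b, X.farDist σ u < X.farDist ψ u) ∨
      ∀ u ∈ Ioo a b, X.farDist ψ u < X.farDist σ u := by
  obtain ⟨f, hf, hfe⟩ := hg.exists_isQuad_eqOn h σ
  obtain ⟨g, hgq, hge⟩ := hg.exists_isQuad_eqOn h ψ
  have hfe' : ∀ u ∈ Ioo a b, X.farDist σ u ^ 2 = f u := hfe
  have hge' : ∀ u ∈ Ioo a b, X.farDist ψ u ^ 2 = g u := hge
  by_cases hfg : f = g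
  · left
    intro u hu
    exact le_antisymm (farDist_le_iff_sq_le.2 (by rw [hfe' u hu, hge' u hu, hfg]))
      (farDist_le_iff_sq_le.2 (by rw [hfe' u hu, hge' u hu, hfg]))
  · right
    have hne : ∀ u ∈ Ioo a b, f u ≠ g u := fun u hu he =>
      hc u hu (mem_crossings_of_eq hg h hf hgq hfe hge hfg hu he)
    by_contra! hcon
    obtain ⟨⟨u, hu, hu'⟩, v, hv, hv'⟩ := hcon
    rw [farDist_le_iff_sq_le, hfe' u hu, hge' u hu] at hu'
    rw [farDist_le_iff_sq_le, hfe' v hv, hge' v hv] at hv'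
    rcases le_total u v with huv | huv
    · obtain ⟨z, hz, he⟩ := exists_eq_of_le_of_ge hgq.continuous hf.continuous huv hu' hv'
      exact hne z ⟨hu.1.trans_le hz.1, hz.2.trans_lt hv.2⟩ he.symm
    · obtain ⟨z, hz, he⟩ := exists_eq_of_le_of_ge hf.continuous hgq.continuous huv hv' hu'
      exact hne z ⟨hv.1.trans_le hz.1, hz.2.trans_lt hu.2⟩ he

end Cuts

end MovingEntities

/-! ### The number of jumps -/

namespace MovingEntities

section Bound

variable {d n τ : ℕ} {X : MovingEntities d n τ} {ε : ℝ}

/-- A central trajectory remains central when it is redirected, during a gap, to an entity of the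
same component that is no less central. -/
theorem IsGap.isCentral_follow (hτ : 1 ≤ τ) {a b : ℝ} (hg : X.IsGap ε a b) {C : ℝ → Fin n}
    (hC : X.IsCentral ε C) {I : Set ℝ} (hI : MeasurableSet I) (hab : I ⊆ Ioo a b) {ψ : Fin n}
    (hψ : ∀ u ∈ I, X.EpsConnected ε u (C u) ψ)
    (hle : ∀ u ∈ I, X.farDist ψ u ≤ X.farDist (C u) u) : X.IsCentral ε (follow C I ψ) := by
  have hT := hg.isTrajectoid_follow hτ hC.1 hI hab hψ
  refine ⟨hT, fun T hT' => le_trans ?_ (hC.2 T hT')⟩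
  refine cost_le_cost hτ hT.1 hC.1.1 (Eventually.of_forall fun u _ => ?_)
  by_cases hu : u ∈ I
  · simpa [follow, hu] using hle u hu
  · simp [follow, hu]

/-- During a gap a central trajectory follows, almost always, a most central entity of its
component. -/
theorem IsGap.ae_farDist_le (hτ : 1 ≤ τ) {a b : ℝ} (hg : X.IsGap ε a b)
    (h : ∀ u ∈ Ioo a b, u ∉ X.cuts ε) {C : ℝ → Fin n} (hC : X.IsCentral ε C) :
    ∀ᵐ u, u ∈ Ioo a b → ∀ ψ, X.EpsConnected ε u (C u) ψ →
      X.farDist (C u) u ≤ X.farDist ψ u := by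
  classical
  suffices hmain : ∀ σ ψ, ∀ᵐ u, u ∈ Ioo a b → C u = σ → X.EpsConnected ε u σ ψ →
      X.farDist σ u ≤ X.farDist ψ u by
    have := ae_all_iff.2 fun σ => ae_all_iff.2 fun ψ => hmain σ ψ
    filter_upwards [this] with u hu hui ψ hψ
    exact hu _ ψ hui rfl hψ
  intro σ ψ
  by_cases hcon : ∃ v ∈ Ioo a b, X.EpsConnected ε v σ ψ
  · obtain ⟨v, hv, hcon⟩ := hcon
    obtain ⟨f, hf, hfe⟩ := hg.exists_isQuad_eqOn h σ
    obtain ⟨g, hgq, hge⟩ := hg.exists_isQuad_eqOn h ψ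
    have hiff : ∀ u ∈ Ioo a b, (X.farDist σ u ≤ X.farDist ψ u ↔ f u ≤ g u) := fun u hu => by
      rw [farDist_le_iff_sq_le, ← hfe hu, ← hge hu]; rfl
    -- Redirect `C` to `ψ` whenever it follows `σ` although `ψ` is more central.
    let I : Set ℝ := Ioo a b ∩ (C ⁻¹' {σ} ∩ {u | g u < f u})
    have hI : MeasurableSet I := measurableSet_Ioo.inter
      ((hC.1.1 (measurableSet_singleton σ)).inter
        (measurableSet_lt hgq.continuous.measurable hf.continuous.measurable))
    have hlt : ∀ u ∈ I, X.farDist ψ u < X.farDist (C u) u := fun u hu => by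
      rw [show C u = σ from hu.2.1, ← not_le, hiff u hu.1, not_le]
      exact hu.2.2
    have hT := hg.isTrajectoid_follow hτ hC.1 hI inter_subset_left (ψ := ψ) fun u hu => by
      rw [show C u = σ from hu.2.1]
      exact hg.epsConnected hτ hv (Ioo_subset_Icc_self hu.1) hcon
    have hae := ae_eq_of_cost_le hτ hT.1 hC.1.1 (Eventually.of_forall fun u _ => by
      by_cases hu : u ∈ I
      · simpa [follow, hu] using (hlt u hu).le
      · simp [follow, hu]) (hC.2 _ hT)
    filter_upwards [hae] with u hu hui hCu _
    rw [hiff u hui]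
    by_contra! hcontra
    have huI : u ∈ I := ⟨hui, hCu, hcontra⟩
    have := hu (hg.Ioo_subset hui)
    simp only [follow, huI, if_true] at this
    exact (hlt u huI).ne this
  · push Not at hcon
    exact Eventually.of_forall fun u hu _ hc => absurd hc (hcon u hu)

theorem frequently_of_ae {P : ℝ → Prop} (h : ∀ᵐ u, P u) (s : ℝ) {l : Filter ℝ}
    (hl : l = 𝓝[<] s ∨ l = 𝓝[>] s) : ∃ᶠ u in l, P u := by
  intro hcon
  have : ∃ p q, p < q ∧ Ioo p q ⊆ {u | ¬ P u} := by
    rcases hl with rfl | rfl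
    · obtain ⟨p, hp, hps⟩ := mem_nhdsLT_iff_exists_Ioo_subset.1 hcon
      exact ⟨p, s, hp, hps⟩
    · obtain ⟨q, hq, hqs⟩ := mem_nhdsGT_iff_exists_Ioo_subset.1 hcon
      exact ⟨s, q, hq, hqs⟩
  obtain ⟨p, q, hpq, hsub⟩ := this
  have h0 : volume (Ioo p q) = 0 := measure_mono_null hsub (ae_iff.1 h)
  rw [Real.volume_Ioo, ENNReal.ofReal_eq_zero] at h0
  linarith

open Classical in
/-- The functions `G σ`, for the entities `σ` in the component of `C m` at time `m`. -/
noncomputable def componentFamily (X : MovingEntities d n τ) (ε : ℝ) (C : ℝ → Fin n) (m : ℝ)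
    (G : Fin n → ℝ → ℝ) : Finset (ℝ → ℝ) :=
  (Finset.univ.filter fun σ => X.EpsConnected ε m (C m) σ).image G

theorem mem_componentFamily {C : ℝ → Fin n} {m : ℝ} {G : Fin n → ℝ → ℝ} {f : ℝ → ℝ} :
    f ∈ X.componentFamily ε C m G ↔ ∃ σ, X.EpsConnected ε m (C m) σ ∧ G σ = f := by
  simp [componentFamily]

/-- Where the lower envelope of the component is locally a single quadratic, every jump is
arbitrary. Hence the other jumps are at breakpoints of that envelope. -/
theorem IsGap.mem_envelopeBreaks (hτ : 1 ≤ τ) {a b : ℝ} (hg : X.IsGap ε a b)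
    (h : ∀ u ∈ Ioo a b, u ∉ X.cuts ε) {C : ℝ → Fin n} (hC : X.IsCentral ε C)
    (hno : X.NoArbitraryJumps ε C) {G : Fin n → ℝ → ℝ} (hG : ∀ σ, IsQuad (G σ))
    (hGe : ∀ σ, EqOn (X.sqFarDist σ) (G σ) (Ioo a b)) {m : ℝ} (hm : m ∈ Ioo a b) {s : ℝ}
    (hs : s ∈ Ioo a b) (hbr : s ∈ X.breakTimes C) :
    s ∈ envelopeBreaks (X.componentFamily ε C m G) a b := by
  refine ⟨hs, ?_⟩
  rintro ⟨f, hf, hmin⟩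
  obtain ⟨i, hi, rfl⟩ := mem_componentFamily.1 hf
  have hspan : s ∈ Ioo (X.time 0) (X.time (Fin.last τ)) :=
    ⟨hg.left_mem.1.trans_lt hs.1, hs.2.trans_le hg.right_mem.2⟩
  have hiff : ∀ σ ψ, ∀ u ∈ Ioo a b, (X.farDist σ u ≤ X.farDist ψ u ↔ G σ u ≤ G ψ u) :=
    fun σ ψ u hu => by
      rw [farDist_le_iff_sq_le, ← hGe σ hu, ← hGe ψ hu]; rfl
  -- The component of `C` does not depend on the time.
  have hmem : ∀ u ∈ Ioo a b, ∀ σ, (X.EpsConnected ε u (C u) σ ↔ X.EpsConnected ε m (C m) σ) := by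
    intro u hu σ
    constructor
    · intro hc
      exact (hg.epsConnected_apply hτ hC.1 hm hu (Ioo_subset_Icc_self hm)).trans
        (hg.epsConnected hτ hu (Ioo_subset_Icc_self hm) hc)
    · intro hc
      exact (hg.epsConnected_apply hτ hC.1 hu hm (Ioo_subset_Icc_self hu)).trans
        (hg.epsConnected hτ hm (Ioo_subset_Icc_self hu) hc)
  have hside : ∀ l : Filter ℝ, l = 𝓝[<] s ∨ l = 𝓝[>] s →
      ∃ σ, (∃ᶠ u in l, C u = σ) ∧ X.EpsConnected ε m (C m) σ ∧ G σ = G i := by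
    intro l hl
    have hls : l ≤ 𝓝[≠] s := by
      rcases hl with rfl | rfl
      · exact nhdsWithin_mono _ fun _ hu => ne_of_lt hu
      · exact nhdsWithin_mono _ fun _ hu => ne_of_gt hu
    have hfr := (frequently_of_ae (hg.ae_farDist_le hτ h hC) s hl).and_eventually
      ((hmin.and (Ioo_mem_nhds hs.1 hs.2)).filter_mono (hls.trans nhdsWithin_le_nhds))
    have hfr' : ∃ᶠ u in l, ∃ σ, C u = σ ∧ X.EpsConnected ε m (C m) σ ∧ G σ u = G i u := by
      refine hfr.mono ?_
      rintro u ⟨hu, hu', hui⟩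
      have hCu := (hmem u hui _).1 (EpsConnected.refl _ _)
      refine ⟨C u, rfl, hCu, le_antisymm ?_ ?_⟩
      · exact (hiff _ _ u hui).1 (hu hui i ((hmem u hui i).2 hi))
      · exact hu' _ (mem_componentFamily.2 ⟨_, hCu, rfl⟩)
    have hex : ∃ σ, ∃ᶠ u in l, C u = σ ∧ X.EpsConnected ε m (C m) σ ∧ G σ u = G i u := by
      by_contra hcon
      rw [not_exists] at hcon
      refine hfr' ((eventually_all.2 fun σ => not_frequently.1 (hcon σ)).mono ?_)
      rintro u hu ⟨σ, hσ⟩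
      exact hu σ hσ
    obtain ⟨σ, hσ⟩ := hex
    exact ⟨σ, hσ.mono fun u hu => hu.1, hσ.exists.choose_spec.2.1,
      (hG σ).eq_of_frequently_eq (hG i) ((hσ.mono fun u hu => hu.2.2).filter_mono hls)⟩
  obtain ⟨σ, hσ, hσm, hσi⟩ := hside _ (Or.inl rfl)
  obtain ⟨ψ, hψ, hψm, hψi⟩ := hside _ (Or.inr rfl)
  refine hno s hbr hspan ⟨σ, ψ, hσ, hψ, ?_⟩
  obtain ⟨p, q, hpq, hsub⟩ := mem_nhds_iff_exists_Ioo_subset.1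
    (hmin.and (Ioo_mem_nhds hs.1 hs.2))
  have hcentral : ∀ χ, X.EpsConnected ε m (C m) χ → G χ = G i → ∀ I : Set ℝ, MeasurableSet I →
      I ⊆ Ioo p q → X.IsCentral ε (follow C I χ) := by
    intro χ hχ hχi I hI hIpq
    have hIab : I ⊆ Ioo a b := fun u hu => (hsub (hIpq hu)).2
    refine hg.isCentral_follow hτ hC hI hIab (fun u hu => (hmem u (hIab hu) χ).2 hχ)
      fun u hu => ?_
    rw [hiff _ _ u (hIab hu), hχi]
    exact (hsub (hIpq hu)).1 _ (mem_componentFamily.2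
      ⟨_, (hmem u (hIab hu) _).1 (EpsConnected.refl _ _), rfl⟩)
  filter_upwards [Ioo_mem_nhdsGT (sub_pos.2 hpq.1), Ioo_mem_nhdsGT (sub_pos.2 hpq.2)]
    with δ hδp hδq
  refine ⟨hcentral σ hσm hσi _ measurableSet_Ico fun u hu => ⟨hpq.1.trans_le hu.1, ?_⟩,
    hcentral ψ hψm hψi _ measurableSet_Ioc fun u hu => ⟨?_, hu.2.trans_lt hpq.2⟩⟩
  · linarith [hu.2, hδq.2]
  · linarith [hu.1, hδp.2]

/-- In a gap, a central trajectory without arbitrary jumps has at most `2 r` jumps, where `r`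
entities cross pairwise during the gap. -/
theorem IsGap.exists_encard_breakTimes_le (hτ : 1 ≤ τ) {a b : ℝ} (hg : X.IsGap ε a b)
    (h : ∀ u ∈ Ioo a b, u ∉ X.cuts ε) {C : ℝ → Fin n} (hC : X.IsCentral ε C)
    (hno : X.NoArbitraryJumps ε C) {P : Finset (Fin n × Fin n)}
    (hP : ∀ σ ψ, (X.crossings σ ψ ∩ Ioo a b).Nonempty → (σ, ψ) ∈ P) :
    ∃ r : ℕ, (X.breakTimes C ∩ Ioo a b).encard ≤ (2 * r : ℕ) ∧ r * r - r ≤ P.card := by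
  classical
  choose G hG hGe using fun σ => hg.exists_isQuad_eqOn h σ
  obtain ⟨m, hm⟩ := exists_between hg.lt
  set F := X.componentFamily ε C m G with hFdef
  have hF : ∀ f ∈ F, IsQuad f := fun f hf => by
    obtain ⟨σ, -, rfl⟩ := mem_componentFamily.1 hf
    exact hG σ
  have hne : F.Nonempty := ⟨G (C m), mem_componentFamily.2 ⟨_, EpsConnected.refl _ _, rfl⟩⟩
  refine ⟨(envelopeMembers F a b).card, ?_, ?_⟩
  · exact (encard_le_encard fun s hs =>
      hg.mem_envelopeBreaks hτ h hC hno hG hGe hm hs.2 hs.1).trans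
      (encard_envelopeBreaks_le hF hne a b)
  · have hpre : ∀ f ∈ envelopeMembers F a b, ∃ σ, G σ = f := fun f hf => by
      obtain ⟨σ, -, rfl⟩ := mem_componentFamily.1 (Finset.mem_filter.1 hf).1
      exact ⟨σ, rfl⟩
    have : Nonempty (Fin n) := ⟨C m⟩
    choose! e he using hpre
    rw [← Finset.offDiag_card]
    refine Finset.card_le_card_of_injOn (fun p => (e p.1, e p.2)) ?_ ?_
    · rintro ⟨f, g⟩ hfg
      obtain ⟨hf, hg', hne⟩ := Finset.mem_offDiag.1 hfg
      obtain ⟨s, hs, heq⟩ := exists_eq_of_mem_envelopeMembers hF hf hg'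
      refine hP _ _ ⟨s, mem_crossings_of_eq hg h (hG _) (hG _) (hGe _) (hGe _) ?_ hs ?_, hs⟩
      · rwa [he f hf, he g hg']
      · rw [he f hf, he g hg']
        exact heq
    · rintro ⟨f, g⟩ hfg ⟨f', g'⟩ hfg' heq
      obtain ⟨hf, hg', -⟩ := Finset.mem_offDiag.1 hfg
      obtain ⟨hf', hg'', -⟩ := Finset.mem_offDiag.1 hfg'
      obtain ⟨h1, h2⟩ := Prod.ext_iff.1 heq
      simp only at h1 h2
      rw [← he f hf, ← he g hg', h1, h2, he f' hf', he g' hg'']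

/-- The vertices that are not cuts lie in `N` gaps, at most `2 r i` of them in the `i`-th one. In that
gap `r i` entities cross pairwise, so that the total number of crossings bounds
`∑ i, (r i ^ 2 - r i)`. -/
theorem encard_vertices_le (hn : 1 ≤ n) (hτ : 1 ≤ τ) {C : ℝ → Fin n} (hC : X.IsCentral ε C)
    (hno : X.NoArbitraryJumps ε C) :
    ∃ (N : ℕ) (r : Fin N → ℕ), N ≤ 6 * τ * n ^ 2 ∧ ∑ i, (r i * r i - r i) ≤ 12 * τ * n ^ 3 ∧
      (X.vertices C).encard ≤ (6 * τ * n ^ 2 + ∑ i, 2 * r i : ℕ) := by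
  classical
  have hcard := encard_cuts_le hn hτ X ε
  have hfin := finite_cuts hn hτ X ε
  rw [hfin.encard_eq_coe_toFinset_card, Nat.cast_le] at hcard
  obtain ⟨N, e, hN, he0, heN, heE, hlt, hgap⟩ := exists_partition (F := hfin.toFinset)
    (a := X.time 0) (b := X.time (Fin.last τ)) (by simp [cuts]) (by simp [cuts])
    (fun x hx => cuts_subset_span (hfin.mem_toFinset.1 hx))
  have hspan : ∀ i ≤ N, e i ∈ X.span := fun i hi =>
    cuts_subset_span (hfin.mem_toFinset.1 (heE i hi))
  have hcut : ∀ i < N, ∀ u ∈ Ioo (e i) (e (i + 1)), u ∉ X.cuts ε := fun i hi u hu huE =>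
    hgap i hi u (hfin.mem_toFinset.2 huE) hu
  have hg : ∀ i < N, X.IsGap ε (e i) (e (i + 1)) := fun i hi =>
    isGap_of_disjoint_cuts (hlt i hi) (hspan i hi.le) (hspan (i + 1) hi) (hcut i hi)
  let rel : Fin N → Fin n × Fin n → Prop := fun i p =>
    (X.crossings p.1 p.2 ∩ Ioo (e i) (e (i + 1))).Nonempty
  choose r hr hr' using fun i : Fin N => (hg i i.2).exists_encard_breakTimes_le hτ (hcut i i.2)
    hC hno (P := Finset.univ.bipartiteAbove rel i) (fun σ ψ hp => by
      simpa [Finset.bipartiteAbove, rel] using hp)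
  refine ⟨N, r, by omega, ?_, ?_⟩
  · -- Count the pairs of a gap and a crossing during it in two ways.
    refine (Finset.sum_le_sum fun i _ => hr' i).trans ?_
    rw [Finset.sum_card_bipartiteAbove_eq_sum_card_bipartiteBelow]
    have hp : ∀ p : Fin n × Fin n, (Finset.univ.bipartiteBelow rel p).card ≤ 12 * τ * n := by
      intro p
      have hc := encard_crossings_le hn hτ X p.1 p.2
      have hcf : (X.crossings p.1 p.2).Finite := finite_of_encard_le_coe hc
      rw [hcf.encard_eq_coe_toFinset_card, Nat.cast_le] at hc
      refine le_trans ?_ hc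
      have hmem : ∀ i ∈ Finset.univ.bipartiteBelow rel p,
          ∃ s, s ∈ X.crossings p.1 p.2 ∩ Ioo (e i) (e (i + 1)) := fun i hi =>
        (Finset.mem_filter.1 hi).2
      choose! x hx using hmem
      refine Finset.card_le_card_of_injOn x (fun i hi => ?_) fun i hi j hj hij => ?_
      · simpa using (hx i hi).1
      · have := hx j hj
        rw [← hij] at this
        exact Fin.ext (gap_injective hlt i.2 j.2 (hx i hi).2 this.2)
    refine (Finset.sum_le_card_nsmul _ _ _ fun p _ => hp p).trans (le_of_eq ?_)
    simp
    ring
  · have hsub : X.vertices C ⊆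
        X.cuts ε ∪ ⋃ i : Fin N, X.breakTimes C ∩ Ioo (e i) (e (i + 1)) := by
      rintro s (hs | hs)
      · by_cases hsE : s ∈ X.cuts ε
        · exact Or.inl hsE
        · obtain ⟨i, hi, hsi⟩ := exists_mem_gap heE (s := s) (by rw [he0, heN]; exact hs.1)
            (fun h => hsE (hfin.mem_toFinset.1 h))
          exact Or.inr (mem_iUnion.2 ⟨⟨i, hi⟩, hs, hsi⟩)
      · exact Or.inl (Or.inl hs)
    refine (encard_le_encard hsub).trans ((encard_union_le _ _).trans
      ((add_le_add (encard_cuts_le hn hτ X ε) (encard_iUnion_le_sum hr)).trans ?_))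
    rw [← Nat.cast_add]

/-- Sum the inequality `r ≤ 1 + √n + (r² - r) / √n` over the gaps. -/
theorem sum_le_of_sum_sq_sub_le {N n τ : ℕ} (hn : 1 ≤ n) {r : Fin N → ℕ} (hN : N ≤ 6 * τ * n ^ 2)
    (hr : ∑ i, (r i * r i - r i) ≤ 12 * τ * n ^ 3) :
    ((6 * τ * n ^ 2 + ∑ i, 2 * r i : ℕ) : ℝ) ≤ 54 * τ * (n : ℝ) ^ (5 / 2 : ℝ) := by
  have hn0 : (0 : ℝ) < n := by exact_mod_cast hn
  set q := √(n : ℝ) with hq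
  have hq1 : 1 ≤ q := Real.one_le_sqrt.2 (by exact_mod_cast hn)
  have hqq : q * q = n := Real.mul_self_sqrt hn0.le
  have hpow : (n : ℝ) ^ (5 / 2 : ℝ) = n ^ 2 * q := by
    rw [hq, Real.sqrt_eq_rpow, ← Real.rpow_natCast, ← Real.rpow_add hn0]
    norm_num
  have hi : ∀ i, (r i : ℝ) * q ≤ (1 + q) * q + ((r i * r i - r i : ℕ) : ℝ) := by
    intro i
    rw [Nat.cast_sub (Nat.le_mul_self _), Nat.cast_mul]
    rcases le_total (r i : ℝ) (1 + q) with h | h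
    · have h0 : (r i : ℝ) ≤ r i * r i := by exact_mod_cast Nat.le_mul_self _
      nlinarith
    · nlinarith
  have hsum : (∑ i, (r i : ℝ)) * q ≤ N * ((1 + q) * q) + 12 * τ * n ^ 3 := by
    rw [Finset.sum_mul]
    refine (Finset.sum_le_sum fun i _ => hi i).trans ?_
    rw [Finset.sum_add_distrib, Finset.sum_const, Finset.card_univ, Fintype.card_fin, nsmul_eq_mul,
      ← Nat.cast_sum]
    gcongr
    exact_mod_cast hr
  have hN' : (N : ℝ) ≤ 6 * τ * n ^ 2 := by exact_mod_cast hN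
  have hA : (0 : ℝ) ≤ τ * n ^ 2 := by positivity
  have hsum' : ∑ i, (r i : ℝ) ≤ 24 * (τ * n ^ 2 * q) := by
    refine le_of_mul_le_mul_right (hsum.trans ?_) (zero_lt_one.trans_le hq1)
    have h1 : (N : ℝ) * ((1 + q) * q) ≤ 6 * τ * n ^ 2 * ((2 * q) * q) := by
      gcongr
      linarith
    have h2 : (12 : ℝ) * τ * n ^ 3 = 12 * τ * n ^ 2 * (q * q) := by rw [hqq]; ring
    rw [h2]
    linarith
  rw [hpow]
  push_cast
  rw [← Finset.mul_sum]
  nlinarith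

end Bound

end MovingEntities

/-! ### Existence -/

namespace MovingEntities

section Existence

variable {d n τ : ℕ} {X : MovingEntities d n τ} {ε : ℝ} {N : ℕ} {e : ℕ → ℝ}

/-- `e 0 < ⋯ < e N` subdivide the time interval so that inside each part there are no cuts and no
crossings: there the components and the order of the values `D(σ, ·)` are fixed. -/
structure IsFine (X : MovingEntities d n τ) (ε : ℝ) (N : ℕ) (e : ℕ → ℝ) : Prop where
  pos : 0 < N
  zero : e 0 = X.time 0
  last : e N = X.time (Fin.last τ)
  lt : ∀ i < N, e i < e (i + 1)
  notMem_cuts : ∀ i < N, ∀ u ∈ Ioo (e i) (e (i + 1)), u ∉ X.cuts ε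
  notMem_crossings : ∀ i < N, ∀ u ∈ Ioo (e i) (e (i + 1)), ∀ σ ψ, u ∉ X.crossings σ ψ

theorem exists_isFine (hn : 1 ≤ n) (hτ : 1 ≤ τ) (X : MovingEntities d n τ) (ε : ℝ) :
    ∃ N e, X.IsFine ε N e := by
  set E : Set ℝ := X.cuts ε ∪ ⋃ p : Fin n × Fin n, X.crossings p.1 p.2 with hE
  have hfin : E.Finite := (finite_cuts hn hτ X ε).union
    (finite_iUnion fun p => finite_of_encard_le_coe (encard_crossings_le hn hτ X p.1 p.2))
  have hspan : E ⊆ X.span :=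
    union_subset cuts_subset_span (iUnion_subset fun p s hs => hs.1)
  obtain ⟨N, e, -, he0, heN, -, hlt, hgap⟩ := exists_partition (F := hfin.toFinset)
    (a := X.time 0) (b := X.time (Fin.last τ)) (by simp [hE, cuts]) (by simp [hE, cuts])
    (fun x hx => hspan (hfin.mem_toFinset.1 hx))
  refine ⟨N, e, ?_, he0, heN, hlt, fun i hi u hu h => ?_, fun i hi u hu σ ψ h => ?_⟩
  · rcases Nat.eq_zero_or_pos N with rfl | h
    · exact absurd (he0.symm.trans heN) (time_zero_lt_last hτ).ne
    · exact h
  · exact hgap i hi u (hfin.mem_toFinset.2 (Or.inl h)) hu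
  · exact hgap i hi u (hfin.mem_toFinset.2 (Or.inr (mem_iUnion.2 ⟨(σ, ψ), h⟩))) hu

namespace IsFine

theorem mem_span (he : X.IsFine ε N e) {i : ℕ} (hi : i ≤ N) : e i ∈ X.span :=
  ⟨he.zero ▸ le_of_lt_succ he.lt (Nat.zero_le i) hi, he.last ▸ le_of_lt_succ he.lt hi le_rfl⟩

theorem isGap (he : X.IsFine ε N e) {i : ℕ} (hi : i < N) : X.IsGap ε (e i) (e (i + 1)) :=
  isGap_of_disjoint_cuts (he.lt i hi) (he.mem_span hi.le) (he.mem_span hi) (he.notMem_cuts i hi)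

theorem trichotomy (he : X.IsFine ε N e) {i : ℕ} (hi : i < N) (σ ψ : Fin n) :
    (∀ u ∈ Ioo (e i) (e (i + 1)), X.farDist σ u = X.farDist ψ u) ∨
      (∀ u ∈ Ioo (e i) (e (i + 1)), X.farDist σ u < X.farDist ψ u) ∨
      ∀ u ∈ Ioo (e i) (e (i + 1)), X.farDist ψ u < X.farDist σ u :=
  (he.isGap hi).farDist_trichotomy (he.notMem_cuts i hi)
    fun u hu => he.notMem_crossings i hi u hu σ ψ

theorem ae_mem_gap (he : X.IsFine ε N e) :
    ∀ᵐ u, u ∈ X.span → ∃ i < N, u ∈ Ioo (e i) (e (i + 1)) := by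
  classical
  set F := (Finset.range (N + 1)).image e with hF
  filter_upwards [F.countable_toSet.ae_notMem volume] with u hu hus
  refine exists_mem_gap (F := F) (fun i hi => ?_) (by rw [he.zero, he.last]; exact hus) hu
  exact Finset.mem_image_of_mem _ (Finset.mem_range.2 (by omega))

end IsFine

open Classical in
/-- The index of the part of the subdivision `e` containing `u`; the parts are `[e i, e (i + 1))`,
except that the first and the last one extend to infinity. -/
noncomputable def stepIndex (N : ℕ) (e : ℕ → ℝ) (u : ℝ) : ℕ :=
  Nat.findGreatest (fun i => e i ≤ u) (N - 1)

/-- The map that takes the value `w i` throughout the `i`-th part of the subdivision. -/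
noncomputable def stepMap (N : ℕ) (e : ℕ → ℝ) (w : ℕ → Fin n) (u : ℝ) : Fin n :=
  w (stepIndex N e u)

/-- The consecutive values `w i` are connected where they meet. -/
def IsFeasible (X : MovingEntities d n τ) (ε : ℝ) (N : ℕ) (e : ℕ → ℝ) (w : ℕ → Fin n) : Prop :=
  ∀ i, i + 1 < N → X.EpsConnected ε (e (i + 1)) (w i) (w (i + 1))

theorem stepIndex_lt (hN : 0 < N) (u : ℝ) : stepIndex N e u < N := by
  classical
  have := Nat.findGreatest_le (P := fun i => e i ≤ u) (N - 1)
  unfold stepIndex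
  omega

theorem stepIndex_last {u : ℝ} (hu : e (N - 1) ≤ u) :
    stepIndex N e u = N - 1 := by
  classical
  exact Nat.findGreatest_eq_iff.2 ⟨le_rfl, fun _ => hu, fun j hij hj => by omega⟩

theorem measurable_stepIndex : Measurable (stepIndex N e) := by
  classical
  exact measurable_findGreatest fun k _ => measurableSet_Ici

namespace IsFine

theorem stepIndex_eq (he : X.IsFine ε N e) {i : ℕ} (hi : i < N) {u : ℝ}
    (hu : u ∈ Ico (e i) (e (i + 1))) : stepIndex N e u = i := by
  classical
  refine Nat.findGreatest_eq_iff.2 ⟨by omega, fun _ => hu.1, fun j hij hj => ?_⟩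
  exact not_le.2 (hu.2.trans_le (le_of_lt_succ he.lt hij (by omega)))

theorem stepMap_eq (he : X.IsFine ε N e) {i : ℕ} (hi : i < N) {u : ℝ}
    (hu : u ∈ Ico (e i) (e (i + 1))) (w : ℕ → Fin n) : stepMap N e w u = w i := by
  rw [stepMap, he.stepIndex_eq hi hu]

theorem isTrajectoid_stepMap (he : X.IsFine ε N e) {w : ℕ → Fin n} (hw : X.IsFeasible ε N e w) :
    X.IsTrajectoid ε (stepMap N e w) := by
  rw [isTrajectoid_iff]
  refine ⟨(measurable_from_top (f := w)).comp measurable_stepIndex, fun s hs => ?_⟩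
  have hs' : s ∈ Icc (e 0) (e N) := by rw [he.zero, he.last]; exact hs
  rcases hs'.2.eq_or_lt with h | h
  · have hN := he.pos
    have hlt : e (N - 1) < s := by
      rw [h]
      exact lt_of_lt_succ he.lt (by omega) le_rfl
    filter_upwards [nhdsWithin_le_nhds (Ioi_mem_nhds hlt)] with u hu
    rw [stepMap, stepMap, stepIndex_last hlt.le, stepIndex_last (le_of_lt hu)]
    exact EpsConnected.refl _ _
  · obtain ⟨i, hi, hsi⟩ := exists_lt_mem_Ico hs'.1 h
    rw [he.stepMap_eq hi hsi]
    rcases hsi.1.eq_or_lt with h1 | h1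
    · subst h1
      rcases i with _ | i
      · filter_upwards [self_mem_nhdsWithin, nhdsWithin_le_nhds (Iio_mem_nhds hsi.2)] with u hu hu'
        rw [he.stepMap_eq hi ⟨he.zero ▸ hu.1, hu'⟩]
        exact EpsConnected.refl _ _
      · filter_upwards [nhdsWithin_le_nhds (Ioo_mem_nhds (he.lt i (by omega)) hsi.2)] with u hu
        rcases lt_or_ge u (e (i + 1)) with h2 | h2
        · rw [he.stepMap_eq (by omega : i < N) ⟨hu.1.le, h2⟩]
          exact (hw i hi).symm
        · rw [he.stepMap_eq hi ⟨h2, hu.2⟩]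
          exact EpsConnected.refl _ _
    · filter_upwards [nhdsWithin_le_nhds (Ioo_mem_nhds h1 hsi.2)] with u hu
      rw [he.stepMap_eq hi (Ioo_subset_Ico_self hu)]
      exact EpsConnected.refl _ _

/-- Every trajectoid is dominated by one that is constant on the parts of a fine subdivision: in
each part it suffices to follow a most central entity of the component visited. -/
theorem exists_isFeasible_cost_le (hτ : 1 ≤ τ) (he : X.IsFine ε N e) {T : ℝ → Fin n}
    (hT : X.IsTrajectoid ε T) :
    ∃ w, X.IsFeasible ε N e w ∧ X.cost (stepMap N e w) ≤ X.cost T := by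
  have key : ∀ i < N, ∃ σ, (∀ u ∈ Ioo (e i) (e (i + 1)), ∀ v ∈ Icc (e i) (e (i + 1)),
      X.EpsConnected ε v (T u) σ) ∧
      ∀ u ∈ Ioo (e i) (e (i + 1)), X.farDist σ u ≤ X.farDist (T u) u := by
    intro i hi
    have hg := he.isGap hi
    obtain ⟨m, hm⟩ := exists_between hg.lt
    obtain ⟨σ, hσ, hmin⟩ := Set.exists_min_image {σ | X.EpsConnected ε m (T m) σ}
      (fun σ => X.farDist σ m) (toFinite _) ⟨T m, EpsConnected.refl _ _⟩
    refine ⟨σ, fun u hu v hv => ?_, fun u hu => ?_⟩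
    · exact (hg.epsConnected_apply hτ hT hu hm hv).trans (hg.epsConnected hτ hm hv hσ)
    · have hm' := hmin (T u) (hg.epsConnected_apply hτ hT hm hu (Ioo_subset_Icc_self hm))
      rcases he.trichotomy hi σ (T u) with h | h | h
      · exact (h u hu).le
      · exact (h u hu).le
      · exact absurd (h m hm) hm'.not_gt
  have : Nonempty (Fin n) := ⟨T 0⟩
  choose! w hw hwle using key
  have hfeas : X.IsFeasible ε N e w := by
    intro i hi
    have hg := he.isGap (by omega : i < N)
    have hg' := he.isGap hi
    have hev := (isTrajectoid_iff.1 hT).2 _ hg.right_mem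
    have := right_nhdsWithin_Ioo_neBot hg.lt
    have := left_nhdsWithin_Ioo_neBot hg'.lt
    obtain ⟨u, hu, hu'⟩ := ((hev.filter_mono (nhdsWithin_mono _ hg.Ioo_subset)).and
      self_mem_nhdsWithin).exists
    obtain ⟨v, hv, hv'⟩ := ((hev.filter_mono (nhdsWithin_mono _ hg'.Ioo_subset)).and
      self_mem_nhdsWithin).exists
    exact (hw i (by omega) u hu' _ (right_mem_Icc.2 hg.lt.le)).symm.trans
      (hu.symm.trans (hv.trans (hw (i + 1) hi v hv' _ (left_mem_Icc.2 hg'.lt.le))))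
  refine ⟨w, hfeas, cost_le_cost hτ (he.isTrajectoid_stepMap hfeas).1 hT.1 ?_⟩
  filter_upwards [he.ae_mem_gap] with u hu hus
  obtain ⟨i, hi, hui⟩ := hu hus
  rw [he.stepMap_eq hi (Ioo_subset_Ico_self hui)]
  exact hwle i hi u hui

/-- At an arbitrary jump of a central step map, the entity left is in the following part connected
to the one entered, and equally central. -/
theorem of_isArbitraryJump (hτ : 1 ≤ τ) (he : X.IsFine ε N e) {w : ℕ → Fin n}
    (hC : X.IsCentral ε (stepMap N e w)) {s : ℝ} (hs : s ∈ X.breakTimes (stepMap N e w))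
    (hsi : s ∈ Ioo (X.time 0) (X.time (Fin.last τ)))
    (harb : X.IsArbitraryJump ε (stepMap N e w) s) :
    ∃ j, j + 1 < N ∧ w j ≠ w (j + 1) ∧
      X.EpsConnected ε (e (j + 2)) (w j) (w (j + 1)) ∧
      ∀ u ∈ Ioo (e (j + 1)) (e (j + 2)), X.farDist (w j) u = X.farDist (w (j + 1)) u := by
  set C := stepMap N e w with hCdef
  rw [← he.zero, ← he.last] at hsi
  obtain ⟨k, hk, hsk⟩ := exists_lt_mem_Ico hsi.1.le hsi.2
  rcases hsk.1.eq_or_lt with h1 | h1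
  swap
  · refine absurd ?_ hs.2
    filter_upwards [nhdsWithin_le_nhds (Ioo_mem_nhds h1 hsk.2)] with u hu
    rw [hCdef, he.stepMap_eq hk (Ioo_subset_Ico_self hu), he.stepMap_eq hk hsk]
  subst h1
  rcases k with _ | j
  · exact absurd hsi.1 (lt_irrefl _)
  have hj : j < N := by omega
  have hleft : ∀ u ∈ Ioo (e j) (e (j + 1)), C u = w j := fun u hu =>
    he.stepMap_eq hj (Ioo_subset_Ico_self hu) w
  have hright : ∀ u ∈ Ico (e (j + 1)) (e (j + 2)), C u = w (j + 1) := fun u hu =>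
    he.stepMap_eq hk hu w
  have hne : w j ≠ w (j + 1) := by
    intro heq
    refine hs.2 ?_
    filter_upwards [nhdsWithin_le_nhds (Ioo_mem_nhds (he.lt j hj) hsk.2)] with u hu
    rw [hright _ hsk]
    rcases lt_or_ge u (e (j + 1)) with h2 | h2
    · rw [hleft u ⟨hu.1, h2⟩, heq]
    · rw [hright u ⟨h2, hu.2⟩]
  obtain ⟨σ, ψ, hσ, -, hev⟩ := harb
  obtain rfl : w j = σ := by
    obtain ⟨u, hu, hu'⟩ := (hσ.and_eventually (Ioo_mem_nhdsLT (he.lt j hj))).exists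
    rw [← hu, hleft u hu']
  obtain ⟨δ, ⟨hc, -⟩, hδ⟩ :=
    (hev.and (Ioo_mem_nhdsGT (sub_pos.2 hsk.2))).exists
  set s := e (j + 1) with hsdef
  have hδ1 : s < s + δ := by linarith [hδ.1]
  have hδ2 : s + δ < e (j + 2) := by linarith [hδ.2]
  have hg := he.isGap hk
  have ht : s + δ ∈ Ioo (e (j + 1)) (e (j + 2)) := ⟨hδ1, hδ2⟩
  have hIsub : Ioo s (s + δ) ⊆ X.span := fun u hu => hg.Ioo_subset ⟨hu.1, hu.2.trans hδ2⟩
  refine ⟨j, hk, hne, ?_, ?_⟩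
  · -- The postponed jump takes place at `s + δ`.
    have hev' := (isTrajectoid_iff.1 hc.1).2 _ (hg.Ioo_subset ht)
    have := right_nhdsWithin_Ioo_neBot hδ1
    obtain ⟨u, hu, hu'⟩ := ((hev'.filter_mono (nhdsWithin_mono _ hIsub)).and
      self_mem_nhdsWithin).exists
    have e1 : follow C (Ico s (s + δ)) (w j) (s + δ) = w (j + 1) := by
      simp only [follow, right_notMem_Ico, if_false]
      exact hright _ ⟨hδ1.le, hδ2⟩
    have e2 : follow C (Ico s (s + δ)) (w j) u = w j := by
      simp [follow, hu'.1.le, hu'.2]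
    rw [e1, e2] at hu
    exact hg.epsConnected hτ ht (right_mem_Icc.2 hg.lt.le) hu.symm
  · -- A strict order of the two values of `D` would make one of the central trajectories cheaper.
    have hval : ∀ u ∈ Ioo s (s + δ), follow C (Ico s (s + δ)) (w j) u = w j ∧ C u = w (j + 1) :=
      fun u hu => ⟨by simp [follow, hu.1.le, hu.2], hright u ⟨hu.1.le, hu.2.trans hδ2⟩⟩
    have hval' : ∀ u, u ≠ s → u ∉ Ioo s (s + δ) → follow C (Ico s (s + δ)) (w j) u = C u := by
      intro u hus hu
      have : u ∉ Ico s (s + δ) := fun h => hu ⟨h.1.lt_of_ne hus.symm, h.2⟩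
      simp [follow, this]
    have hae : ∀ᵐ u : ℝ, u ≠ s := (countable_singleton s).ae_notMem volume
    rcases he.trichotomy hk (w j) (w (j + 1)) with h | h | h
    · exact h
    · have := ae_eq_of_cost_le hτ hc.1.1 hC.1.1 (by
        filter_upwards [hae] with u hus _
        by_cases hu : u ∈ Ioo s (s + δ)
        · rw [(hval u hu).1, (hval u hu).2]
          exact (h u ⟨hu.1, hu.2.trans hδ2⟩).le
        · rw [hval' u hus hu]) (hC.2 _ hc.1)
      obtain ⟨u, hu, heq⟩ := exists_mem_Ioo_of_ae this hδ1 hIsub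
      rw [(hval u hu).1, (hval u hu).2] at heq
      exact absurd heq (h u ⟨hu.1, hu.2.trans hδ2⟩).ne
    · have := ae_eq_of_cost_le hτ hC.1.1 hc.1.1 (by
        filter_upwards [hae] with u hus _
        by_cases hu : u ∈ Ioo s (s + δ)
        · rw [(hval u hu).1, (hval u hu).2]
          exact (h u ⟨hu.1, hu.2.trans hδ2⟩).le
        · rw [hval' u hus hu]) (hc.2 _ hC.1)
      obtain ⟨u, hu, heq⟩ := exists_mem_Ioo_of_ae this hδ1 hIsub
      rw [(hval u hu).1, (hval u hu).2] at heq
      exact absurd heq (h u ⟨hu.1, hu.2.trans hδ2⟩).ne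

end IsFine

/-- Among the optimal step maps, one whose jumps come as late as possible, in the lexicographic
sense, has no arbitrary jumps, because none of its jumps can be postponed. -/
theorem exists_isCentral_noArbitraryJumps (hn : 1 ≤ n) (hτ : 1 ≤ τ) (X : MovingEntities d n τ)
    (ε : ℝ) : ∃ C : ℝ → Fin n, X.IsCentral ε C ∧ X.NoArbitraryJumps ε C := by
  classical
  obtain ⟨N, e, he⟩ := exists_isFine hn hτ X ε
  let σ₀ : Fin n := ⟨0, hn⟩
  -- Only the first `N` values of a sequence matter, which leaves finitely many.
  let ext : (Fin N → Fin n) → ℕ → Fin n := fun v i => if h : i < N then v ⟨i, h⟩ else σ₀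
  have hext : ∀ w : ℕ → Fin n, ∀ i < N, ext (fun i => w i) i = w i := fun w i hi => by
    simp [ext, hi]
  let S : Set (Fin N → Fin n) := {v | X.IsFeasible ε N e (ext v)}
  have hdom : ∀ w, X.IsFeasible ε N e w → ∃ v ∈ S, stepMap N e (ext v) = stepMap N e w := by
    intro w hw
    refine ⟨fun i => w i, fun i hi => ?_, ?_⟩
    · rw [hext w i (by omega), hext w (i + 1) hi]
      exact hw i hi
    · funext u
      exact hext w _ (stepIndex_lt he.pos u)
  obtain ⟨v₀, hv₀, -⟩ := hdom (fun _ => σ₀) fun _ _ => EpsConnected.refl _ _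
  let c : (Fin N → Fin n) → ℝ := fun v => X.cost (stepMap N e (ext v))
  obtain ⟨v₁, hv₁, hmin₁⟩ := Set.exists_min_image S c (toFinite _) ⟨v₀, hv₀⟩
  let flags : (Fin N → Fin n) → Lex (Fin N → ℕ) := fun v =>
    toLex fun i => if ext v i = ext v (i + 1) then 0 else 1
  obtain ⟨v, ⟨hv, hvc⟩, hmin⟩ := Set.exists_min_image {v | v ∈ S ∧ c v ≤ c v₁} flags (toFinite _)
    ⟨v₁, hv₁, le_rfl⟩
  have hC : X.IsCentral ε (stepMap N e (ext v)) := by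
    refine ⟨he.isTrajectoid_stepMap hv, fun T hT => ?_⟩
    obtain ⟨w, hw, hwT⟩ := he.exists_isFeasible_cost_le hτ hT
    obtain ⟨v', hv', hv'w⟩ := hdom w hw
    refine hvc.trans ((hmin₁ v' hv').trans ?_)
    simp only [c, hv'w, hwT]
  refine ⟨_, hC, fun s hs hsi harb => ?_⟩
  obtain ⟨j, hj, hne, hcon, heq⟩ := he.of_isArbitraryJump hτ hC hs hsi harb
  -- Postponing the jump at `e (j + 1)` to `e (j + 2)` keeps the cost.
  let v' : Fin N → Fin n := Function.update v ⟨j + 1, hj⟩ (ext v j)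
  have hv'j : ext v' (j + 1) = ext v j := by
    simp only [ext, v', hj, dif_pos, Function.update_self]
  have hv'ne : ∀ i, i ≠ j + 1 → ext v' i = ext v i := by
    intro i hi
    by_cases h : i < N
    · simp only [ext, v', h, dif_pos]
      rw [Function.update_of_ne (by simpa [Fin.ext_iff] using hi)]
    · simp only [ext, h, dif_neg, not_false_eq_true]
  have hv'S : v' ∈ S := by
    intro i hi
    rcases eq_or_ne i j with rfl | h1
    · rw [hv'j, hv'ne i (by omega)]
      exact EpsConnected.refl _ _
    · rcases eq_or_ne i (j + 1) with rfl | h2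
      · rw [hv'j, hv'ne (j + 1 + 1) (by omega)]
        exact hcon.trans (hv (j + 1) hi)
      · rw [hv'ne i h2, hv'ne (i + 1) (by omega)]
        exact hv i hi
  have hv'c : c v' ≤ c v := by
    refine cost_le_cost hτ (he.isTrajectoid_stepMap hv'S).1 hC.1.1 ?_
    filter_upwards [he.ae_mem_gap] with u hu hus
    obtain ⟨i, hi, hui⟩ := hu hus
    rw [he.stepMap_eq hi (Ioo_subset_Ico_self hui), he.stepMap_eq hi (Ioo_subset_Ico_self hui)]
    rcases eq_or_ne i (j + 1) with rfl | h
    · rw [hv'j]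
      exact (heq u hui).le
    · rw [hv'ne i h]
  refine (hmin v' ⟨hv'S, hv'c.trans hvc⟩).not_gt ⟨⟨j, by omega⟩, fun i hi => ?_, ?_⟩
  · have hij : (i : ℕ) < j := hi
    simp only [flags, Pi.toLex_apply]
    rw [hv'ne i (by omega), hv'ne (i + 1) (by omega)]
  · simp only [flags, Pi.toLex_apply]
    rw [hv'j, hv'ne j (by omega), if_pos rfl, if_neg hne]
    exact zero_lt_one

end Existence

end MovingEntities

theorem mainTheorem4 :
    ∃ K : ℝ, ∀ (d n τ : ℕ), 1 ≤ n → 1 ≤ τ → ∀ (X : MovingEntities d n τ) (ε : ℝ),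
      (∃ C : ℝ → Fin n, X.IsCentral ε C ∧ X.NoArbitraryJumps ε C) ∧
      ∀ C : ℝ → Fin n, X.IsCentral ε C → X.NoArbitraryJumps ε C →
        (X.vertices C).Finite ∧
          ((X.vertices C).ncard : ℝ) ≤ K * (τ : ℝ) * (n : ℝ) ^ (5 / 2 : ℝ) := by
  refine ⟨54, fun d n τ hn hτ X ε =>
    ⟨MovingEntities.exists_isCentral_noArbitraryJumps hn hτ X ε, fun C hC hno => ?_⟩⟩
  obtain ⟨N, r, hN, hr, hle⟩ := MovingEntities.encard_vertices_le hn hτ hC hno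
  have hfin : (X.vertices C).Finite := finite_of_encard_le_coe hle
  refine ⟨hfin, le_trans ?_ (MovingEntities.sum_le_of_sum_sq_sub_le hn hN hr)⟩
  rw [← hfin.cast_ncard_eq, Nat.cast_le] at hle
  exact_mod_cast hle
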